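/- Let $q=e^{2\pi i\tau}$, $\zeta=e^{2\pi i z}$, and for $m\in\mathbb Z$ put $$\eta(\tau)=q^{1/24}\prod_{n\ge1}(1-q^n),\qquad \theta(mz;\tau)=q^{1/8}(\zeta^{m/2}-\zeta^{-m/2})\prod_{n\ge1}(1-q^n)(1-\zeta^{m}q^n)(1-\zeta^{-m}q^n),$$ $$\theta^*(mz;\tau)=q^{1/24}(\zeta^{m/2}+\zeta^{-m/2})\prod_{n\ge1}(1-q^n)(1+\zeta^{m}q^n)(1+\zeta^{-m}q^n)(1-\zeta^{2m}q^{2n-1})(1-\zeta^{-2m}q^{2n-1}),$$ regarded as formal series in rational powers of $q$ with coefficients in $\mathbb Z[\zeta^{1/2},\zeta^{-1/2}]$. For $h\in\{4,6,8,10,14\}$ and $a,b\in\mathbb Z$ let $\phi_R(az,bz;\tau)$ be the theta block - $h=4$, $R=A_1\oplus A_1$: $\ \theta(az)\,\theta^*(bz)$; - $h=6$, $R=A_1\oplus A_1$: $\ \theta(az)\,\theta(bz)$; - $h=8$, $R=A_2$: $\ \eta^{-1}\theta(az)\,\theta(bz)\,\theta((a+b)z)$; - $h=10$, $R=B_2$: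 $\ \eta^{-2}\theta(az)\,\theta(bz)\,\theta((a+b)z)\,\theta((a+2b)z)$; - $h=14$, $R=G_2$: $\ \eta^{-4}\theta(az)\,\theta(bz)\,\theta((a+b)z)\,\theta((2a+b)z)\,\theta((3a+b)z)\,\theta((3a+2b)z)$ (the argument $\tau$ being omitted). Let $k,h,t$ be positive integers, $\ell$ a prime and $\delta=\delta_{k,\ell}$ an integer with $k+h=\ell t$ and $24\delta\equiv k\pmod\ell$, and suppose that one of the following holds: $h\in\{4,8,14\}$ and $\ell\equiv2\pmod3$; or $h\in\{6,10\}$ and $\ell\equiv3\pmod4$; or $h=26$ and $\ell\equiv11\pmod{12}$. If $\ell\in\{2,3\}$ (where $24\delta\equiv k\pmod\ell$ does not determine $\delta$ modulo $\ell$), suppose also that $\ell\nmid\delta$. Then $\{\ell n+\delta\}_{n\ge0}$ is called a congruence progression. It is called singular if either (i) there is an odd prime $p\equiv2\pmod3$ with $p\mid k+14$, and $\ell\equiv2\pmod3$ and $\ell\mid k+8$; or (ii) $\ell\equiv11\pmod{12}$ and $\ell\mid k+26$; otherwise it is called generic. **Lemma.** Suppose that $\{\ell n+\delta_{k,\ell}\}_{n\ge0}$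 is a generic congruence progression as above, with $k+h=\ell t$ and $h\in\{4,6,8,10,14\}$, and let $\phi_R$ be the theta block associated with $h$. Then for all integers $a,b$ and all $n\ge0$, the cyclotomic polynomial $\Phi_\ell(\zeta)$ divides, in $\mathbb Z[\zeta^{1/2},\zeta^{-1/2}]$, the coefficient of $q^{\ell n+\delta_{k,\ell}+h/24}$ in $\phi_R(az,bz;\tau)$. -/

import Mathlib

/-!
Formal `q`-expansions. The variable `T` of `ℤ[T;T⁻¹]` stands for `ζ^{1/2}`, so `T m` is `ζ^{m/2}`;
a function of `τ` with Fourier coefficients in `ℤ[ζ^{1/2}, ζ^{-1/2}]` and rational exponents of `q`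
is an element of `HahnSeries ℚ ℤ[T;T⁻¹]`, whose coefficient at `r : ℚ` is the coefficient of `q^r`.
-/

namespace ThetaBlock

/-- Laurent polynomials over `ℤ` in `ζ^{1/2}`. -/
abbrev ZetaRing : Type := LaurentPolynomial ℤ

/-- `ζ^{m/2}`. -/
noncomputable def zetaHalf (m : ℤ) : ZetaRing := LaurentPolynomial.T m

/-- `ζ^m`. -/
noncomputable def zeta (m : ℤ) : ZetaRing := LaurentPolynomial.T (2 * m)

/-- Power series in `q` with coefficients in `ℤ[ζ^{1/2}, ζ^{-1/2}]`. -/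
abbrev QSeries : Type := PowerSeries ZetaRing

/-- Formal series in rational powers of `q` with coefficients in `ℤ[ζ^{1/2}, ζ^{-1/2}]`. -/
abbrev QRatSeries : Type := HahnSeries ℚ ZetaRing

/-- `q^r` for a rational number `r`. -/
noncomputable def qPow (r : ℚ) : QRatSeries := HahnSeries.single r 1

/-- A power series in `q`, regarded as a series in rational powers of `q`. -/
noncomputable def ofQSeries : QSeries →+* QRatSeries := HahnSeries.ofPowerSeries ℚ ZetaRing

/-- A coefficient in `ℤ[ζ^{1/2}, ζ^{-1/2}]`, regarded as a constant `q`-series. -/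
noncomputable def const : ZetaRing →+* QRatSeries := HahnSeries.C

/-- The constant power series `c` (in the variable `q`). -/
noncomputable def cst : ZetaRing →+* QSeries := PowerSeries.C

/-- The infinite product `∏_{n ≥ 1} f n` of power series in `q`, for the `q`-adic topology
(coefficientwise convergence, the coefficient ring being discrete). -/
noncomputable def qProd (f : ℕ → QSeries) : QSeries :=
  letI : TopologicalSpace ZetaRing := ⊥
  letI : TopologicalSpace QSeries := PowerSeries.WithPiTopology.instTopologicalSpace ZetaRing
  ∏' n : ℕ, f (n + 1)

/-- `∏_{n ≥ 1} (1 - q^n)`. -/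
noncomputable def eulerProd : QSeries := qProd fun n => 1 - PowerSeries.X ^ n

/-- `η(τ) = q^{1/24} ∏_{n ≥ 1} (1 - q^n)`. -/
noncomputable def eta : QRatSeries := qPow (1 / 24) * ofQSeries eulerProd

/-- `η(τ)⁻¹`; see `eta_mul_etaInv`. -/
noncomputable def etaInv : QRatSeries :=
  qPow (-(1 / 24)) * ofQSeries (PowerSeries.invOfUnit eulerProd 1)

/-- `θ(mz; τ) = q^{1/8} (ζ^{m/2} - ζ^{-m/2}) ∏_{n ≥ 1} (1 - q^n)(1 - ζ^m q^n)(1 - ζ^{-m} q^n)`. -/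
noncomputable def theta (m : ℤ) : QRatSeries :=
  qPow (1 / 8) * const (zetaHalf m - zetaHalf (-m)) *
    ofQSeries (qProd fun n =>
      (1 - PowerSeries.X ^ n) * (1 - cst (zeta m) * PowerSeries.X ^ n) *
        (1 - cst (zeta (-m)) * PowerSeries.X ^ n))

/-- `θ*(mz; τ) = η(τ) θ(2mz; τ) / θ(mz; τ)`, defined (also for `m = 0`) by its product expansion
`q^{1/24} (ζ^{m/2} + ζ^{-m/2}) ∏_{n ≥ 1}
  (1 - q^n)(1 + ζ^m q^n)(1 + ζ^{-m} q^n)(1 - ζ^{2m} q^{2n-1})(1 - ζ^{-2m} q^{2n-1})`. -/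
noncomputable def thetaStar (m : ℤ) : QRatSeries :=
  qPow (1 / 24) * const (zetaHalf m + zetaHalf (-m)) *
    ofQSeries (qProd fun n =>
      (1 - PowerSeries.X ^ n) *
        (1 + cst (zeta m) * PowerSeries.X ^ n) * (1 + cst (zeta (-m)) * PowerSeries.X ^ n) *
        (1 - cst (zeta (2 * m)) * PowerSeries.X ^ (2 * n - 1)) *
        (1 - cst (zeta (-(2 * m))) * PowerSeries.X ^ (2 * n - 1)))

/-- The theta block `φ_R(az, bz; τ)` of weight one with character `ε^h`, for
`h = 4, 6` (`R = A₁ ⊕ A₁`), `h = 8` (`R = A₂`), `h = 10` (`R = B₂`) and `h = 14` (`R = G₂`).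
Other values of `h` are not used, and are given the value `0`. -/
noncomputable def phi (h : ℕ) (a b : ℤ) : QRatSeries :=
  match h with
  | 4 => theta a * thetaStar b
  | 6 => theta a * theta b
  | 8 => etaInv * theta a * theta b * theta (a + b)
  | 10 => etaInv ^ 2 * theta a * theta b * theta (a + b) * theta (a + 2 * b)
  | 14 => etaInv ^ 4 * theta a * theta b * theta (a + b) * theta (2 * a + b) *
      theta (3 * a + b) * theta (3 * a + 2 * b)
  | _ => 0

/-- `Φ_ℓ(ζ)`, the `ℓ`-th cyclotomic polynomial evaluated at `ζ`. -/
noncomputable def cyclotomicZeta (ℓ : ℕ) : ZetaRing :=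
  Polynomial.aeval (zeta 1) (Polynomial.cyclotomic ℓ ℤ)

/-- The data `k + h = ℓ t`, `24 δ ≡ k (mod ℓ)` of a congruence progression `{ℓ n + δ}_{n ≥ 0}` for
`p_k(n)` modulo the prime `ℓ`.
The last condition concerns only `ℓ = 2` and `ℓ = 3`, where `24 δ ≡ k (mod ℓ)` does not determine
`δ` modulo `ℓ`; it says that `0` is not in the residue class of the progression
(recall `p_k(0) = 1`). -/
structure IsCongruenceProgression (k ℓ h t : ℕ) (δ : ℤ) : Prop where
  prime : ℓ.Prime
  k_pos : 0 < k
  h_pos : 0 < h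
  t_pos : 0 < t
  add_eq : k + h = ℓ * t
  delta : 24 * δ ≡ (k : ℤ) [ZMOD (ℓ : ℤ)]
  cond : ((h = 4 ∨ h = 8 ∨ h = 14) ∧ ℓ ≡ 2 [MOD 3]) ∨
    ((h = 6 ∨ h = 10) ∧ ℓ ≡ 3 [MOD 4]) ∨
    (h = 26 ∧ ℓ ≡ 11 [MOD 12])
  nondegenerate : ℓ ∣ 24 → ¬ (ℓ : ℤ) ∣ δ

/-- The condition on `k` and `ℓ` for a congruence progression to be singular. -/
def IsSingular (k ℓ : ℕ) : Prop :=
  ((∃ p : ℕ, p.Prime ∧ Odd p ∧ p ≡ 2 [MOD 3] ∧ p ∣ k + 14) ∧ ℓ ≡ 2 [MOD 3] ∧ ℓ ∣ k + 8) ∨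
    (ℓ ≡ 11 [MOD 12] ∧ ℓ ∣ k + 26)

/-- A generic congruence progression is a congruence progression that is not singular. -/
def IsGenericProgression (k ℓ h t : ℕ) (δ : ℤ) : Prop :=
  IsCongruenceProgression k ℓ h t δ ∧ ¬ IsSingular k ℓ

/-! ### The infinite products converge, and `etaInv` is the inverse of `eta` -/

theorem coeff_mul_of_dvd (g u : QSeries) {M N : ℕ} (hN : N ≤ M)
    (hu : PowerSeries.X ^ (M + 1) ∣ u - 1) :
    PowerSeries.coeff N (g * u) = PowerSeries.coeff N g := by
  have h1 : PowerSeries.X ^ (M + 1) ∣ g * u - g := by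
    have : g * u - g = g * (u - 1) := by ring
    rw [this]; exact hu.mul_left g
  have h2 := PowerSeries.X_pow_dvd_iff.1 h1 N (by omega)
  rw [map_sub, sub_eq_zero] at h2
  exact h2

theorem X_pow_dvd_prod_sub_one (f : ℕ → QSeries)
    (hf : ∀ n, PowerSeries.X ^ (n + 1) ∣ f (n + 1) - 1) (M : ℕ) (s : Finset ℕ)
    (hs : ∀ n ∈ s, M ≤ n) : PowerSeries.X ^ (M + 1) ∣ (∏ n ∈ s, f (n + 1)) - 1 := by
  induction s using Finset.induction_on with
  | empty => simp
  | insert i s hi ih =>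
    rw [Finset.prod_insert hi]
    have h1 : PowerSeries.X ^ (M + 1) ∣ f (i + 1) - 1 :=
      (pow_dvd_pow _ (by have := hs i (Finset.mem_insert_self _ _); omega)).trans (hf i)
    have h2 := ih fun n hn => hs n (Finset.mem_insert_of_mem hn)
    have : f (i + 1) * ∏ n ∈ s, f (n + 1) - 1 =
        (f (i + 1) - 1) * ∏ n ∈ s, f (n + 1) + ((∏ n ∈ s, f (n + 1)) - 1) := by ring
    rw [this]
    exact (h1.mul_right _).add h2

theorem hasProd_mk [TopologicalSpace ZetaRing]
    (f : ℕ → QSeries) (hf : ∀ n, PowerSeries.X ^ (n + 1) ∣ f (n + 1) - 1) :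
    @HasProd QSeries ℕ _ (PowerSeries.WithPiTopology.instTopologicalSpace ZetaRing)
      (fun n : ℕ => f (n + 1))
      (PowerSeries.mk fun N => PowerSeries.coeff N (∏ n ∈ Finset.range N, f (n + 1)))
      (SummationFilter.unconditional ℕ) := by
  let _ : TopologicalSpace QSeries := PowerSeries.WithPiTopology.instTopologicalSpace ZetaRing
  unfold HasProd
  rw [SummationFilter.unconditional_filter,
    PowerSeries.WithPiTopology.tendsto_iff_coeff_tendsto]
  intro N
  apply tendsto_const_nhds.congr'
  filter_upwards [Filter.eventually_ge_atTop (Finset.range N)] with s hs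
  rw [PowerSeries.coeff_mk, ← Finset.prod_sdiff (show Finset.range N ⊆ s from hs), mul_comm,
    coeff_mul_of_dvd _ _ le_rfl]
  apply X_pow_dvd_prod_sub_one f hf
  intro n hn
  simpa using (Finset.mem_sdiff.1 hn).2

/-- If `f n ≡ 1` modulo `q^n` for all `n ≥ 1`, the infinite product `∏_{n ≥ 1} f n` converges
(see `hasProd_mk`), and its coefficient at `q^N` is that of `∏_{n = 1}^N f n`. -/
theorem coeff_qProd (f : ℕ → QSeries) (hf : ∀ n, PowerSeries.X ^ (n + 1) ∣ f (n + 1) - 1)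
    (N : ℕ) : PowerSeries.coeff N (qProd f) =
      PowerSeries.coeff N (∏ n ∈ Finset.range N, f (n + 1)) := by
  let _ : TopologicalSpace ZetaRing := ⊥
  have _ : DiscreteTopology ZetaRing := ⟨rfl⟩
  let _ : TopologicalSpace QSeries := PowerSeries.WithPiTopology.instTopologicalSpace ZetaRing
  have _ : T2Space QSeries := PowerSeries.WithPiTopology.instT2Space ZetaRing
  have h' : qProd f = _ := (hasProd_mk f hf).tprod_eq
  rw [h', PowerSeries.coeff_mk]

/-- The factors of `η` satisfy the convergence condition. -/
theorem eulerProd_factor (n : ℕ) :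
    (PowerSeries.X : QSeries) ^ (n + 1) ∣ (1 - PowerSeries.X ^ (n + 1)) - 1 :=
  ⟨-1, by ring⟩

/-- The factors of `θ(mz; τ)` satisfy the convergence condition. -/
theorem theta_factor (c d : QSeries) (n : ℕ) :
    (PowerSeries.X : QSeries) ^ (n + 1) ∣
      (1 - PowerSeries.X ^ (n + 1)) * (1 - c * PowerSeries.X ^ (n + 1)) *
        (1 - d * PowerSeries.X ^ (n + 1)) - 1 := by
  generalize hy : (PowerSeries.X : QSeries) ^ (n + 1) = y
  exact ⟨-1 - c - d + (c + d + c * d) * y - c * d * y ^ 2, by ring⟩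

/-- The factors of `θ*(mz; τ)` satisfy the convergence condition. -/
theorem thetaStar_factor (c d c' d' : QSeries) (n : ℕ) :
    (PowerSeries.X : QSeries) ^ (n + 1) ∣
      (1 - PowerSeries.X ^ (n + 1)) *
        (1 + c * PowerSeries.X ^ (n + 1)) * (1 + d * PowerSeries.X ^ (n + 1)) *
        (1 - c' * PowerSeries.X ^ (2 * (n + 1) - 1)) *
        (1 - d' * PowerSeries.X ^ (2 * (n + 1) - 1)) - 1 := by
  have hx : (PowerSeries.X : QSeries) ^ (2 * (n + 1) - 1) =
      PowerSeries.X ^ (n + 1) * PowerSeries.X ^ n := by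
    rw [← pow_add]; congr 1; omega
  rw [hx]
  generalize (PowerSeries.X : QSeries) ^ (n + 1) = y
  generalize (PowerSeries.X : QSeries) ^ n = w
  rw [← Ideal.mem_span_singleton, ← Ideal.Quotient.eq_zero_iff_mem]
  have hy : Ideal.Quotient.mk (Ideal.span {y}) y = 0 :=
    Ideal.Quotient.eq_zero_iff_mem.2 (Ideal.mem_span_singleton_self y)
  simp [hy]

theorem constantCoeff_eulerProd : PowerSeries.constantCoeff eulerProd = 1 := by
  rw [← PowerSeries.coeff_zero_eq_constantCoeff_apply, eulerProd,
    coeff_qProd _ eulerProd_factor]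
  simp

theorem eta_mul_etaInv : eta * etaInv = 1 := by
  have h1 : eulerProd * PowerSeries.invOfUnit eulerProd 1 = 1 :=
    PowerSeries.mul_invOfUnit _ _ (by simp [constantCoeff_eulerProd])
  have h2 : qPow (1 / 24) * qPow (-(1 / 24)) = 1 := by
    simp [qPow, HahnSeries.single_mul_single]
  rw [eta, etaInv, mul_mul_mul_comm, h2, ← map_mul, h1, map_one, mul_one]

end ThetaBlock

/-!
A theta block attached to a root system of rank two is, up to a power of `q`, a power series in `q`
whose coefficients are Laurent polynomials in two exponentials (`TwoVar`); the arguments `a`, `b`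
enter only through the specialization `spec a b` of the exponentials. Three facts about this power
series `F` give the divisibility for `h = 8, 10, 14`.

* `F` satisfies a heat equation (`heat_A2`, `heat_B2`, `heat_G2`), whose second-order operator is
  the invariant Laplacian of the root system. Hence the exponential `e(i, j)` occurs in the
  coefficient of `q^N` only if `Q(i, j) = 24 N + h` up to a fixed factor, for a definite form `Q`
  (`support_of_heat`).
* The form `Q` is anisotropic modulo `ℓ`, as `-1`, respectively `-3`, is not a square modulo `ℓ`.
  If `ℓ` is odd and divides `24 N + h`, then all exponents `(i, j)` which occur are divisible by
  `ℓ`; as their parity is determined by `Q`, they are congruent to each other modulo `2 ℓ`, and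
  their exponentials become equal modulo `Φ_ℓ(ζ)`.
* The coefficients add up to zero, because `F` vanishes at `ζ = 1`
  (`cyclotomicZeta_dvd_coeff_map_spec`).

The heat equations are formal consequences of the heat equations of the unary theta series `θ` and
`η` and of a single bilinear identity, `three_term`, for `θ(x) θ(y) θ(x + y) / η`. The latter is
proved by a sign-reversing involution of the index set of a fourfold sum. Applied to `x = y`, it
also gives the heat equation of `θ*`, and thereby the shape of the exponents in the quintuple
product (`sq_of_coeff_thetaStarSeries_ne_zero`), without determining the signs. The passage from
infinite products to sums uses the Jacobi triple product, obtained from its finite form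
`finite_jacobi`.

For `h = 4` and `h = 6` the block is a product of two unary series. A pair of exponents occurring
in the coefficient of `q^N` satisfies `3 x² + y² = 24 N + 4`, respectively
`3 (x² + y²) = 24 N + 6`, and anisotropy shows `ℓ ∣ x`; then a pair of opposite exponentials
`ζ^{± a x / 2}` cancels modulo `Φ_ℓ(ζ)`. The primes `2` and `3` need separate arguments. For `ℓ = 2`
and `h = 8, 14` one of the factors `θ(az)`, `θ(bz)`, `θ((a+b)z)` vanishes at `ζ = -1`. For `ℓ = 2`,
`h = 4` and for `ℓ = 3`, `h = 6` the condition that `ℓ` does not divide `δ` is needed: in the former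
case the block becomes `q^{1/6}` times a series in `q²` (`coeff_odd_prod_eq_zero`), unless one
of its factors vanishes; in the latter, the squares modulo `3` are inspected.
-/

namespace ThetaBlock

/-! ### Formal sums of monomials -/

section Series

variable {R ι κ : Type*} [CommRing R]

/-- The formal sum `∑ i, c i * q ^ d i`, for an exponent function `d` with finite fibres
(see `IsProper`). -/
noncomputable def ser (d : ι → ℕ) (c : ι → R) : PowerSeries R :=
  PowerSeries.mk fun n => ∑ᶠ i ∈ {i | d i = n}, c i

/-- The exponent function `d` takes values `≤ N` only finitely often, for every `N`. -/
def IsProper (d : ι → ℕ) : Prop := ∀ N, {i | d i ≤ N}.Finite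

theorem IsProper.add {d : ι → ℕ} {d' : κ → ℕ} (hd : IsProper d) (hd' : IsProper d') :
    IsProper fun p : ι × κ => d p.1 + d' p.2 := fun N =>
  ((hd N).prod (hd' N)).subset fun p (hp : d p.1 + d' p.2 ≤ N) =>
    ⟨by simp only [Set.mem_ofPred_eq]; omega, by simp only [Set.mem_ofPred_eq]; omega⟩

theorem coeff_ser {d : ι → ℕ} (c : ι → R) {N n : ℕ} (hn : n ≤ N) (S : Finset ι)
    (hS : ∀ i, d i ≤ N → i ∈ S) :
    PowerSeries.coeff n (ser d c) = ∑ i ∈ S, if d i = n then c i else 0 := by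
  classical
  rw [ser, PowerSeries.coeff_mk, ← Finset.sum_filter]
  rw [finsum_mem_eq_sum_of_inter_support_eq (t := S.filter fun i => d i = n)]
  ext i
  simp only [Set.mem_inter_iff, Set.mem_ofPred_eq, Finset.coe_filter]
  constructor
  · rintro ⟨h, h'⟩; exact ⟨⟨hS i (h.trans_le hn), h⟩, h'⟩
  · rintro ⟨⟨_, h⟩, h'⟩; exact ⟨h, h'⟩

theorem ser_mul {d : ι → ℕ} {d' : κ → ℕ} (hd : IsProper d) (hd' : IsProper d')
    (c : ι → R) (c' : κ → R) :
    ser d c * ser d' c' = ser (fun p : ι × κ => d p.1 + d' p.2) fun p => c p.1 * c' p.2 := by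
  classical
  ext N
  have h1 : ∀ i, d i ≤ N → i ∈ (hd N).toFinset := fun i hi => by simpa using hi
  have h2 : ∀ i, d' i ≤ N → i ∈ (hd' N).toFinset := fun i hi => by simpa using hi
  rw [coeff_ser _ le_rfl ((hd N).toFinset ×ˢ (hd' N).toFinset) fun p hp =>
    Finset.mem_product.2 ⟨h1 _ (by omega), h2 _ (by omega)⟩, PowerSeries.coeff_mul]
  have : ∀ p ∈ Finset.HasAntidiagonal.antidiagonal N,
      PowerSeries.coeff p.1 (ser d c) * PowerSeries.coeff p.2 (ser d' c') =
        ∑ x ∈ (hd N).toFinset ×ˢ (hd' N).toFinset,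
          if (d x.1, d' x.2) = p then c x.1 * c' x.2 else 0 := by
    intro p hp
    have hp' := Finset.HasAntidiagonal.mem_antidiagonal.1 hp
    rw [coeff_ser _ (show p.1 ≤ N by omega) _ h1, coeff_ser _ (show p.2 ≤ N by omega) _ h2,
      Finset.sum_mul_sum, Finset.sum_product]
    refine Finset.sum_congr rfl fun i _ => Finset.sum_congr rfl fun j _ => ?_
    simp only [Prod.ext_iff]
    split_ifs <;> simp_all
  rw [Finset.sum_congr rfl this, Finset.sum_comm]
  refine Finset.sum_congr rfl fun x _ => ?_
  rw [Finset.sum_ite_eq]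
  simp

/-- An involution of the index set that preserves the exponents and changes the sign of the
coefficients makes the sum vanish. -/
theorem ser_eq_zero_of_involution [IsAddTorsionFree R] {d : ι → ℕ} (hd : IsProper d) (c : ι → R)
    (σ : ι → ι) (hσ : Function.Involutive σ) (hdσ : ∀ i, d (σ i) = d i)
    (hcσ : ∀ i, c (σ i) = -c i) : ser d c = 0 := by
  classical
  ext N
  rw [coeff_ser _ le_rfl (hd N).toFinset fun i hi => by simpa using hi, map_zero]
  refine Finset.sum_involution (fun i _ => σ i) ?_ ?_ ?_ fun i _ => hσ i
  · intro i _
    rw [hdσ, hcσ]; split_ifs <;> simp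
  · intro i _ h0 h1
    apply h0
    have h2 := hcσ i
    rw [h1] at h2
    rw [self_eq_neg.1 h2, ite_self]
  · intro i hi
    simpa [hdσ] using hi

theorem ser_sub (d : ι → ℕ) (hd : IsProper d) (c c' : ι → R) :
    ser d c - ser d c' = ser d fun i => c i - c' i := by
  ext N
  have h1 : ∀ i, d i ≤ N → i ∈ (hd N).toFinset := fun i hi => by simpa using hi
  rw [map_sub, coeff_ser _ le_rfl _ h1, coeff_ser _ le_rfl _ h1, coeff_ser _ le_rfl _ h1,
    ← Finset.sum_sub_distrib]
  exact Finset.sum_congr rfl fun i _ => by split_ifs <;> simp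

theorem ser_add (d : ι → ℕ) (hd : IsProper d) (c c' : ι → R) :
    ser d c + ser d c' = ser d fun i => c i + c' i := by
  ext N
  have h1 : ∀ i, d i ≤ N → i ∈ (hd N).toFinset := fun i hi => by simpa using hi
  rw [map_add, coeff_ser _ le_rfl _ h1, coeff_ser _ le_rfl _ h1, coeff_ser _ le_rfl _ h1,
    ← Finset.sum_add_distrib]
  exact Finset.sum_congr rfl fun i _ => by split_ifs <;> simp

theorem map_ser {S : Type*} [CommRing S] (f : R →+* S) {d : ι → ℕ} (hd : IsProper d) (c : ι → R) :
    PowerSeries.map f (ser d c) = ser d fun i => f (c i) := by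
  ext N
  have h1 : ∀ i, d i ≤ N → i ∈ (hd N).toFinset := fun i hi => by simpa using hi
  rw [PowerSeries.coeff_map, coeff_ser _ le_rfl _ h1, coeff_ser _ le_rfl _ h1, map_sum]
  exact Finset.sum_congr rfl fun i _ => by split_ifs <;> simp

end Series

/-! ### The Jacobi triple product -/

section JacobiTripleProduct

open PowerSeries

variable {R : Type*} [CommRing R]

variable (R) in
/-- The finite product `∏_{k = 1}^m (1 - q^k)`. -/
noncomputable def qFac (m : ℕ) : PowerSeries R := ∏ k ∈ Finset.range m, (1 - X ^ (k + 1))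

variable (R) in
/-- The inverse of `qFac R m`. -/
noncomputable def qFacInv (m : ℕ) : PowerSeries R := invOfUnit (qFac R m) 1

theorem qFac_succ (m : ℕ) : qFac R (m + 1) = qFac R m * (1 - X ^ (m + 1)) :=
  Finset.prod_range_succ _ _

theorem qFac_mul_qFacInv (m : ℕ) : qFac R m * qFacInv R m = 1 :=
  mul_invOfUnit _ _ (by simp [qFac, map_prod])

theorem qFacInv_eq (m : ℕ) : qFacInv R m = (1 - X ^ (m + 1)) * qFacInv R (m + 1) := by
  have h1 := qFac_mul_qFacInv (R := R) m
  have h2 := qFac_mul_qFacInv (R := R) (m + 1)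
  rw [qFac_succ] at h2
  linear_combination ((1 - X ^ (m + 1)) * qFacInv R (m + 1)) * h1 - qFacInv R m * h2

variable (R) in
/-- The Gaussian binomial coefficient `[2n+1 choose n-i]` in the variable `q`. -/
noncomputable def qBin (n i : ℕ) : PowerSeries R :=
  if i ≤ n then qFac R (2 * n + 1) * qFacInv R (n - i) * qFacInv R (n + 1 + i) else 0

theorem qBin_of_lt {n i : ℕ} (h : n < i) : qBin R n i = 0 := if_neg (by omega)

theorem qBin_add (i r : ℕ) : qBin R (i + r) i =
    qFac R (2 * (i + r) + 1) * qFacInv R r * qFacInv R (2 * i + r + 1) := by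
  rw [qBin, if_pos (by omega)]
  congr 2
  · congr 1; omega
  · omega

/-- The three-term recurrence of `[2n+1 choose n-i]` that comes from applying the `q`-Pascal rule
twice; it describes multiplication by `(1 - x² q^{n+1})(1 - y² q^{n+1})` in the sum of
`finite_jacobi`. -/
theorem qBin_succ_succ (n i : ℕ) : qBin R (n + 1) (i + 1) =
    (1 + X ^ (2 * n + 2)) * qBin R n (i + 1) + X ^ (n - i) * qBin R n i +
      X ^ (n + 3 + i) * qBin R n (i + 2) := by
  rcases lt_or_ge n i with h | h
  · simp [qBin_of_lt (R := R) h, qBin_of_lt (R := R) (show n < i + 1 by omega),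
      qBin_of_lt (R := R) (show n < i + 2 by omega),
      qBin_of_lt (R := R) (show n + 1 < i + 1 by omega)]
  obtain ⟨r, rfl⟩ := Nat.exists_eq_add_of_le h
  have e0 : qBin R (i + r + 1) (i + 1) = qFac R (2 * (i + r) + 1) * (1 - X ^ (2 * (i + r) + 2)) *
      (1 - X ^ (2 * (i + r) + 3)) * qFacInv R r * qFacInv R (2 * i + r + 3) := by
    rw [show i + r + 1 = (i + 1) + r by omega, qBin_add,
      show 2 * (i + 1 + r) + 1 = 2 * (i + r) + 1 + 1 + 1 by omega, qFac_succ, qFac_succ,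
      show 2 * (i + 1) + r + 1 = 2 * i + r + 3 by omega]
  have v1 := qFacInv_eq (R := R) (2 * i + r + 1)
  have v2 := qFacInv_eq (R := R) (2 * i + r + 2)
  rw [e0, qBin_add, Nat.add_sub_cancel_left, v1, v2]
  obtain _ | _ | r := r
  · rw [qBin_of_lt (show i + 0 < i + 1 by omega), qBin_of_lt (show i + 0 < i + 2 by omega)]
    ring
  · rw [qBin_of_lt (show i + (0 + 1) < i + 2 by omega),
      show i + (0 + 1) = (i + 1) + 0 by omega, qBin_add,
      show 2 * (i + 1) + 0 + 1 = 2 * i + (0 + 1) + 2 by omega, v2, qFacInv_eq (R := R) 0]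
    ring
  · rw [show i + (r + 1 + 1) = (i + 1) + (r + 1) by omega, qBin_add,
      show i + 1 + (r + 1) = (i + 2) + r by omega, qBin_add,
      show 2 * (i + 1) + (r + 1) + 1 = 2 * i + (r + 1 + 1) + 2 by omega, v2,
      show 2 * (i + 2) + r + 1 = 2 * i + (r + 1 + 1) + 3 by omega,
      qFacInv_eq (R := R) r, qFacInv_eq (R := R) (r + 1)]
    ring

/-- The case of `qBin_succ_succ` at the boundary, where the binomial coefficient of index `-1`
coincides with that of index `0`. -/
theorem qBin_succ_zero (n : ℕ) : qBin R (n + 1) 0 =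
    (1 + X ^ (2 * n + 2)) * qBin R n 0 + X ^ (n + 1) * qBin R n 0 + X ^ (n + 2) * qBin R n 1 := by
  have e0 : ∀ m, qBin R m 0 = qFac R (2 * m + 1) * qFacInv R m * qFacInv R (m + 1) := fun m => by
    simpa using qBin_add (R := R) 0 m
  have v1 := qFacInv_eq (R := R) (n + 1)
  rw [e0, e0, show 2 * (n + 1) + 1 = 2 * n + 1 + 1 + 1 by omega, qFac_succ, qFac_succ]
  obtain _ | n := n
  · rw [qBin_of_lt (show 0 < 1 by omega), v1, qFacInv_eq (R := R) 0, v1]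
    ring
  · rw [show n + 1 = 1 + n by omega, qBin_add, show 2 * 1 + n + 1 = 1 + n + 1 + 1 by omega,
      show 1 + n = n + 1 by omega, qFacInv_eq (R := R) n, qFacInv_eq (R := R) (n + 1), v1]
    ring

/-- Summation by parts: for `x y = 1`, multiplication by `x² + y²` shifts the odd powers of `x` and
`y` up and down by two. -/
theorem add_sq_mul_sum (x y : PowerSeries R) (hxy : x * y = 1) (f : ℕ → PowerSeries R) (m : ℕ) :
    (x ^ 2 + y ^ 2) * ∑ i ∈ Finset.range (m + 1), f i * (x ^ (2 * i + 1) - y ^ (2 * i + 1)) =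
      (f 1 - f 0) * (x - y) +
      ∑ i ∈ Finset.range m, (f i + f (i + 2)) * (x ^ (2 * i + 3) - y ^ (2 * i + 3)) +
      f m * (x ^ (2 * m + 3) - y ^ (2 * m + 3)) -
      f (m + 1) * (x ^ (2 * m + 1) - y ^ (2 * m + 1)) := by
  induction m with
  | zero =>
    simp only [zero_add, Finset.sum_range_one, mul_zero, Finset.range_zero, Finset.sum_empty]
    linear_combination f 0 * (y - x) * hxy
  | succ m ih =>
    rw [Finset.sum_range_succ, mul_add, ih, Finset.sum_range_succ]
    have e : ∀ u : PowerSeries R, u ^ (2 * (m + 1) + 1) = u ^ (2 * m + 1) * u ^ 2 :=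
      fun u => by ring
    have e' : ∀ u : PowerSeries R, u ^ (2 * (m + 1) + 3) = u ^ (2 * m + 1) * u ^ 4 :=
      fun u => by ring
    have e3 : ∀ u : PowerSeries R, u ^ (2 * m + 3) = u ^ (2 * m + 1) * u ^ 2 := fun u => by ring
    simp only [e, e', e3, show m + 1 + 1 = m + 2 by omega]
    linear_combination f (m + 1) * (x * y + 1) * (x ^ (2 * m + 1) - y ^ (2 * m + 1)) * hxy

/-- The finite form of the Jacobi triple product, a case of the `q`-binomial theorem. -/
theorem finite_jacobi (x y : PowerSeries R) (hxy : x * y = 1) (n : ℕ) :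
    (x - y) * ∏ k ∈ Finset.range n, (1 - x ^ 2 * X ^ (k + 1)) * (1 - y ^ 2 * X ^ (k + 1)) =
      ∑ i ∈ Finset.range (n + 1), ((-1) ^ i * X ^ (i * (i + 1) / 2) * qBin R n i) *
        (x ^ (2 * i + 1) - y ^ (2 * i + 1)) := by
  have tri : ∀ i : ℕ, (i + 1) * (i + 1 + 1) / 2 = i * (i + 1) / 2 + (i + 1) := fun i => by
    rw [show (i + 1) * (i + 1 + 1) = i * (i + 1) + (i + 1) * 2 by ring,
      Nat.add_mul_div_right _ _ two_pos]
  induction n with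
  | zero =>
    have := qFac_mul_qFacInv (R := R) 1
    have h0 := qFac_mul_qFacInv (R := R) 0
    simp only [qFac, Finset.range_zero, Finset.prod_empty, one_mul] at h0
    simp [qBin, h0, this]
  | succ n ih =>
    -- multiply the `n`-th identity by `1 + q^{2n+2} - q^{n+1} (x² + y²)` and use the recurrence
    set f : ℕ → PowerSeries R := fun i => (-1) ^ i * X ^ (i * (i + 1) / 2) * qBin R n i with hf
    have hP := add_sq_mul_sum x y hxy f n
    have hf1 : f (n + 1) = 0 := by simp [hf, qBin_of_lt (R := R) (show n < n + 1 by omega)]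
    replace ih : (x - y) * ∏ k ∈ Finset.range n, (1 - x ^ 2 * X ^ (k + 1)) *
        (1 - y ^ 2 * X ^ (k + 1)) =
        ∑ i ∈ Finset.range (n + 1), f i * (x ^ (2 * i + 1) - y ^ (2 * i + 1)) := ih
    rw [Finset.prod_range_succ, ← mul_assoc, ih]
    have e1 : (1 - x ^ 2 * X ^ (n + 1)) * (1 - y ^ 2 * X ^ (n + 1)) =
        1 + X ^ (2 * n + 2) - X ^ (n + 1) * (x ^ 2 + y ^ 2) := by
      linear_combination X ^ (2 * n + 2) * (x * y + 1) * hxy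
    rw [e1, mul_sub, mul_comm _ (X ^ (n + 1) * _), mul_assoc, hP, hf1, zero_mul, sub_zero,
      Finset.sum_range_succ' _ (n + 1), Finset.sum_range_succ']
    have e2 : ∀ i, ((-1) ^ (i + 1) * X ^ ((i + 1) * (i + 1 + 1) / 2) * qBin R (n + 1) (i + 1)) =
        (1 + X ^ (2 * n + 2)) * f (i + 1) - X ^ (n + 1) * (f i + f (i + 2)) := by
      intro i
      rcases lt_or_ge n i with h | h
      · simp [hf, qBin_of_lt (R := R) h, qBin_of_lt (R := R) (show n < i + 1 by omega),
          qBin_of_lt (R := R) (show n < i + 2 by omega),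
          qBin_of_lt (R := R) (show n + 1 < i + 1 by omega)]
      · simp only [hf]
        obtain ⟨r, rfl⟩ := Nat.exists_eq_add_of_le h
        rw [qBin_succ_succ, show i + 2 = i + 1 + 1 by omega, tri (i + 1), tri i,
          Nat.add_sub_cancel_left]
        ring
    simp only [e2]
    rw [Finset.sum_range_succ _ n]
    have e3 := qBin_succ_zero (R := R) n
    have hf2 : f (n + 2) = 0 := by simp [hf, qBin_of_lt (R := R) (show n < n + 2 by omega)]
    simp only [sub_mul, Finset.sum_sub_distrib, mul_assoc, ← Finset.mul_sum, hf1, hf2,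
      show ∀ i, 2 * (i + 1) + 1 = 2 * i + 3 from fun i => by ring]
    have f0 : f 0 = qBin R n 0 := by simp [hf]
    have f1 : f 1 = - X * qBin R n 1 := by simp [hf]
    rw [f0, f1, e3]
    ring

theorem X_pow_dvd_qFac_sub (M j : ℕ) :
    (X : PowerSeries R) ^ (M + 1) ∣ qFac R (M + j) - qFac R M := by
  induction j with
  | zero => simp
  | succ j ih =>
    rw [← add_assoc, qFac_succ, show qFac R (M + j) * (1 - X ^ (M + j + 1)) - qFac R M =
      (qFac R (M + j) - qFac R M) - X ^ (M + 1) * (X ^ j * qFac R (M + j)) by ring]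
    exact dvd_sub ih (dvd_mul_right _ _)

theorem X_pow_dvd_qFac_mul_sub_one {M m : ℕ} (h : M ≤ m) :
    (X : PowerSeries R) ^ (M + 1) ∣ qFac R m * qFacInv R M - 1 := by
  obtain ⟨j, rfl⟩ := Nat.exists_eq_add_of_le h
  rw [← qFac_mul_qFacInv (R := R) M, ← sub_mul]
  exact (X_pow_dvd_qFac_sub M j).mul_right _

theorem X_pow_dvd_qFac_mul_qBin_sub_one {n i : ℕ} (h : i ≤ n) :
    (X : PowerSeries R) ^ (n - i + 1) ∣ qFac R n * qBin R n i - 1 := by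
  rw [qBin, if_pos h]
  have h1 := X_pow_dvd_qFac_mul_sub_one (R := R) (show n - i ≤ n by omega)
  have h2 := (pow_dvd_pow (X : PowerSeries R) (show n - i + 1 ≤ n + 1 + i + 1 by omega)).trans
    (X_pow_dvd_qFac_mul_sub_one (R := R) (show n + 1 + i ≤ 2 * n + 1 by omega))
  rw [show qFac R n * (qFac R (2 * n + 1) * qFacInv R (n - i) * qFacInv R (n + 1 + i)) - 1 =
    (qFac R n * qFacInv R (n - i) - 1) * (qFac R (2 * n + 1) * qFacInv R (n + 1 + i)) +
    (qFac R (2 * n + 1) * qFacInv R (n + 1 + i) - 1) by ring]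
  exact (h1.mul_right _).add h2

/-- The **Jacobi triple product**, as an identity for the coefficient of `q^N` in all sufficiently
long partial products. -/
theorem jacobi_coeff (x y : R) (hxy : x * y = 1) (N n : ℕ) (hn : 2 * N ≤ n) :
    coeff N (C (x - y) * ∏ k ∈ Finset.range n, (1 - X ^ (k + 1)) * (1 - C (x ^ 2) * X ^ (k + 1)) *
        (1 - C (y ^ 2) * X ^ (k + 1))) =
      ∑ i ∈ Finset.range (N + 1), if i * (i + 1) / 2 = N then
        (-1) ^ i * (x ^ (2 * i + 1) - y ^ (2 * i + 1)) else 0 := by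
  have h := finite_jacobi (C x) (C y) (by rw [← map_mul, hxy, map_one]) n
  have e : C (x - y) * ∏ k ∈ Finset.range n, (1 - X ^ (k + 1)) * (1 - C (x ^ 2) * X ^ (k + 1)) *
        (1 - C (y ^ 2) * X ^ (k + 1)) = qFac R n * ((C x - C y) *
        ∏ k ∈ Finset.range n, (1 - C x ^ 2 * X ^ (k + 1)) * (1 - C y ^ 2 * X ^ (k + 1))) := by
    simp only [Finset.prod_mul_distrib, map_sub, map_pow, qFac]
    ring
  rw [e, h, Finset.mul_sum, map_sum]
  have hle : ∀ i, i ≤ i * (i + 1) / 2 := fun i => by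
    rw [Nat.le_div_iff_mul_le two_pos]
    rcases i with _ | i
    · simp
    · nlinarith
  symm
  apply Finset.sum_subset_zero_on_sdiff (Finset.range_subset_range.2 (by omega))
  · intro i hi
    simp only [Finset.mem_sdiff, Finset.mem_range] at hi
    have : N < i * (i + 1) / 2 := by have := hle i; omega
    rw [show ∀ a b c d e : PowerSeries R, a * (b * c * d * e) = c * (a * b * d * e) by
      intros; ring, coeff_X_pow_mul', if_neg (by omega)]
  · intro i hi
    simp only [Finset.mem_range] at hi
    obtain ⟨g, hg⟩ := X_pow_dvd_qFac_mul_qBin_sub_one (R := R) (show i ≤ n by omega)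
    have e2 : qFac R n * ((-1) ^ i * X ^ (i * (i + 1) / 2) * qBin R n i *
        (C x ^ (2 * i + 1) - C y ^ (2 * i + 1))) =
        X ^ (i * (i + 1) / 2) * C ((-1) ^ i * (x ^ (2 * i + 1) - y ^ (2 * i + 1))) +
        X ^ (n - i + 1) * (g * X ^ (i * (i + 1) / 2) *
          C ((-1) ^ i * (x ^ (2 * i + 1) - y ^ (2 * i + 1)))) := by
      simp only [map_mul, map_sub, map_pow, map_neg, map_one]
      linear_combination ((-1) ^ i * X ^ (i * (i + 1) / 2) *
        (C x ^ (2 * i + 1) - C y ^ (2 * i + 1))) * hg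
    have e3 : ∀ p : PowerSeries R, coeff N (X ^ (n - i + 1) * p) = 0 := fun p => by
      rw [coeff_X_pow_mul', if_neg (by omega)]
    rw [e2, map_add, e3, add_zero, coeff_X_pow_mul']
    by_cases hN : i * (i + 1) / 2 = N
    · simp [hN]
    · rw [if_neg hN]
      split_ifs with h3
      · rw [coeff_C, if_neg (by omega)]
      · rfl

end JacobiTripleProduct

/-! ### Theta series and the three-term identity -/

section ThetaSeries

/-- The triangular number `i (i + 1) / 2`, for an integer `i`. -/
def tri (i : ℤ) : ℕ := (i * (i + 1) / 2).toNat

theorem two_mul_tri (i : ℤ) : 2 * (tri i : ℤ) = i * (i + 1) := by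
  have h : 0 ≤ i * (i + 1) := by
    rcases le_or_gt 0 i with h | h <;> nlinarith
  rw [tri, Int.toNat_of_nonneg (by omega)]
  exact Int.two_mul_ediv_two_of_even (Int.even_mul_succ_self i)

theorem isProper_tri : IsProper tri := fun N =>
  (Set.finite_Icc (-(N + 1) : ℤ) N).subset fun i (hi : tri i ≤ N) => by
    have h := two_mul_tri i
    zify at hi
    constructor <;> nlinarith

theorem isProper_pentagonal : IsProper pentagonal := fun N =>
  (Set.finite_Icc (-N : ℤ) N).subset fun i (hi : pentagonal i ≤ N) => by
    have h := two_mul_natCast_pentagonal i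
    zify at hi
    constructor <;> nlinarith

variable {G : Type*} [AddCommGroup G]

/-- The theta series `∑ (-1)^i (2i+1)^k q^{i(i+1)/2} e((2i+1) g)` over all integers `i`; for `k = 0`
it is `q^{-1/8} θ` in the direction of `g`, and increasing `k` by one amounts to differentiating
along `g`. -/
noncomputable def th (k : ℕ) (g : G) : PowerSeries (AddMonoidAlgebra ℤ G) :=
  ser tri fun i => AddMonoidAlgebra.single ((2 * i + 1) • g) (i.negOnePow * (2 * i + 1) ^ k)

variable (G) in
/-- The series `∑ (-1)^p (6p-1)^k q^{p(3p-1)/2}` over all integers `p`; for `k = 0` it is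
`q^{-1/24} η`. -/
noncomputable def et (k : ℕ) : PowerSeries (AddMonoidAlgebra ℤ G) :=
  ser pentagonal fun p => AddMonoidAlgebra.single 0 (p.negOnePow * (6 * p - 1) ^ k)

instance : IsAddTorsionFree (AddMonoidAlgebra ℤ G) where
  nsmul_right_injective n hn x y h := by
    ext g
    have h1 := congrArg (fun z : AddMonoidAlgebra ℤ G => z.coeff g) h
    simp only [AddMonoidAlgebra.coeff_smul, Finsupp.smul_apply] at h1
    exact nsmul_right_injective hn h1

/-- The index set of the fourfold sums in the three-term identity. -/
abbrev Quad : Type := ((ℤ × ℤ) × ℤ) × ℤ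

/-- The involution of the index set behind the three-term identity. With `w = 2 (i + j - k) + 1`
it fixes `i + k` and `j + k`; it replaces `w` by `-w` if `3 ∣ w`, and otherwise exchanges the two
numbers `w` and `6 p - 1` up to sign. -/
def quadSwap (v : Quad) : Quad :=
  let u := v.1.1.1 + v.1.1.2 - v.1.2
  let s := if u % 3 = 1 then 2 * (u / 3) + 1 else if u % 3 = 2 then u / 3 + 1 - v.2 else v.2 + u / 3
  (((v.1.1.1 - s, v.1.1.2 - s), v.1.2 + s),
    if u % 3 = 1 then v.2 else if u % 3 = 2 then u / 3 + 1 else -(u / 3))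

/-- The three cases in the definition of `quadSwap`, each written without division. -/
theorem quad_cases {P : Quad → Prop}
    (h1 : ∀ i j t p, P (((i, j), i + j - (3 * t + 1)), p))
    (h2 : ∀ i j t p, P (((i, j), i + j - (3 * t - 1)), p))
    (h0 : ∀ i j t p, P (((i, j), i + j + 3 * t), p)) (v : Quad) : P v := by
  obtain ⟨⟨⟨i, j⟩, k⟩, p⟩ := v
  rcases (by omega : (i + j - k) % 3 = 1 ∨ (i + j - k) % 3 = 2 ∨ (i + j - k) % 3 = 0)
    with h | h | h
  · convert h1 i j ((i + j - k) / 3) p using 3; omega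
  · convert h2 i j ((i + j - k) / 3 + 1) p using 3; omega
  · convert h0 i j (-((i + j - k) / 3)) p using 3; omega

theorem quadSwap_one (i j t p : ℤ) : quadSwap (((i, j), i + j - (3 * t + 1)), p) =
    (((i - (2 * t + 1), j - (2 * t + 1)), i + j - (3 * t + 1) + (2 * t + 1)), p) := by
  have e1 : i + j - (i + j - (3 * t + 1)) = 3 * t + 1 := by ring
  have e2 : (3 * t + 1) % 3 = 1 := by omega
  have e3 : (3 * t + 1) / 3 = t := by omega
  simp only [quadSwap, e1, e2, e3, if_true]

theorem quadSwap_two (i j t p : ℤ) : quadSwap (((i, j), i + j - (3 * t - 1)), p) =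
    (((i - (t - p), j - (t - p)), i + j - (3 * t - 1) + (t - p)), t) := by
  have e1 : i + j - (i + j - (3 * t - 1)) = 3 * t - 1 := by ring
  have e2 : (3 * t - 1) % 3 = 2 := by omega
  have e3 : (3 * t - 1) / 3 + 1 = t := by omega
  simp only [quadSwap, e1, e2, e3, if_true, show ¬ (2 : ℤ) = 1 by omega, if_false]

theorem quadSwap_zero (i j t p : ℤ) : quadSwap (((i, j), i + j + 3 * t), p) =
    (((i - (p - t), j - (p - t)), i + j + 3 * t + (p - t)), t) := by
  have e1 : i + j - (i + j + 3 * t) = -3 * t := by ring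
  have e2 : (-3 * t) % 3 = 0 := by omega
  have e3 : (-3 * t) / 3 = -t := by omega
  simp only [quadSwap, e1, e2, e3, show ¬ (0 : ℤ) = 1 by omega, show ¬ (0 : ℤ) = 2 by omega,
    if_false, neg_neg, ← sub_eq_add_neg]

theorem quadSwap_involutive : Function.Involutive quadSwap := by
  refine quad_cases ?_ ?_ ?_ <;> intro i j t p
  · rw [quadSwap_one, show i + j - (3 * t + 1) + (2 * t + 1) =
      i - (2 * t + 1) + (j - (2 * t + 1)) - (3 * (-t - 1) + 1) by ring, quadSwap_one]
    ext <;> dsimp only <;> ring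
  · rw [quadSwap_two, show i + j - (3 * t - 1) + (t - p) =
      i - (t - p) + (j - (t - p)) - (3 * p - 1) by ring, quadSwap_two]
    ext <;> dsimp only <;> ring
  · rw [quadSwap_zero, show i + j + 3 * t + (p - t) =
      i - (p - t) + (j - (p - t)) + 3 * p by ring, quadSwap_zero]
    ext <;> dsimp only <;> ring

/-- The exponent of `q` in the fourfold sums. -/
def quadDeg (v : Quad) : ℕ := tri v.1.1.1 + tri v.1.1.2 + tri v.1.2 + pentagonal v.2

theorem isProper_quadDeg : IsProper quadDeg :=
  ((isProper_tri.add isProper_tri).add isProper_tri).add isProper_pentagonal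

theorem quadDeg_quadSwap (v : Quad) : quadDeg (quadSwap v) = quadDeg v := by
  have key : ∀ v : Quad, 2 * (quadDeg v : ℤ) = v.1.1.1 * (v.1.1.1 + 1) + v.1.1.2 * (v.1.1.2 + 1) +
      v.1.2 * (v.1.2 + 1) + v.2 * (3 * v.2 - 1) := fun v => by
    rw [← two_mul_tri, ← two_mul_tri, ← two_mul_tri, ← two_mul_natCast_pentagonal, quadDeg]
    push_cast; ring
  have : 2 * (quadDeg (quadSwap v) : ℤ) = 2 * (quadDeg v : ℤ) := by
    rw [key, key]
    revert v
    refine quad_cases ?_ ?_ ?_ <;> intro i j t p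
    · rw [quadSwap_one]; ring
    · rw [quadSwap_two]; ring
    · rw [quadSwap_zero]; ring
  omega

/-- The coefficient in the fourfold sums, apart from the exponential. -/
def quadSign (v : Quad) : ℤ :=
  v.1.1.1.negOnePow * v.1.1.2.negOnePow * v.1.2.negOnePow * v.2.negOnePow

theorem quadSign_eq (v : Quad) :
    quadSign v = (v.1.1.1 + v.1.1.2 + v.1.2 + v.2).negOnePow := by
  simp [quadSign, Int.negOnePow_add]

/-- The summand of the difference of both sides of the three-term identity changes its sign under
`quadSwap`. -/
theorem quadSign_mul_quadSwap (v : Quad) :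
    quadSign (quadSwap v) * ((2 * ((quadSwap v).1.1.1 + (quadSwap v).1.1.2 - (quadSwap v).1.2) + 1)
        ^ 2 - (6 * (quadSwap v).2 - 1) ^ 2) =
      -(quadSign v * ((2 * (v.1.1.1 + v.1.1.2 - v.1.2) + 1) ^ 2 - (6 * v.2 - 1) ^ 2)) := by
  rw [quadSign_eq, quadSign_eq]
  revert v
  refine quad_cases ?_ ?_ ?_ <;> intro i j t p
  · rw [quadSwap_one]
    dsimp only
    rw [show i - (2 * t + 1) + (j - (2 * t + 1)) + (i + j - (3 * t + 1) + (2 * t + 1)) + p =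
      (i + j + (i + j - (3 * t + 1)) + p) - (2 * t + 1) by ring, Int.negOnePow_sub _ (2 * t + 1),
      Int.negOnePow_two_mul_add_one]
    push_cast
    ring
  · rw [quadSwap_two]
    dsimp only
    rw [show i - (t - p) + (j - (t - p)) + (i + j - (3 * t - 1) + (t - p)) + t =
      i + j + (i + j - (3 * t - 1)) + p by ring]
    ring
  · rw [quadSwap_zero]
    dsimp only
    rw [show i - (p - t) + (j - (p - t)) + (i + j + 3 * t + (p - t)) + t =
      (i + j + (i + j + 3 * t) + p) - 2 * (p - t) by ring, Int.negOnePow_sub _ (2 * (p - t)),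
      Int.negOnePow_two_mul]
    push_cast
    ring

/-- The exponential `e(v)` in the fourfold sums. -/
def quadExp (x y : G) (v : Quad) : G :=
  (2 * v.1.1.1 + 1) • x + (2 * v.1.1.2 + 1) • y + (2 * v.1.2 + 1) • (x + y)

theorem quadExp_quadSwap (x y : G) (v : Quad) : quadExp x y (quadSwap v) = quadExp x y v := by
  have h : ∀ v : Quad, quadExp x y v =
      (2 * (v.1.1.1 + v.1.2) + 2) • x + (2 * (v.1.1.2 + v.1.2) + 2) • y := fun v => by
    rw [quadExp]; module
  rw [h, h]
  simp only [quadSwap]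
  congr 2 <;> ring

/-- The fourfold sums that occur in the three-term identity, written over one index set. -/
theorem th_mul_th_mul_th_mul_et (x y : G) (a b c d : ℕ) :
    th a x * th b y * th c (x + y) * et G d = ser quadDeg fun v =>
      AddMonoidAlgebra.single (quadExp x y v) (quadSign v * ((2 * v.1.1.1 + 1) ^ a *
        (2 * v.1.1.2 + 1) ^ b * (2 * v.1.2 + 1) ^ c * (6 * v.2 - 1) ^ d)) := by
  rw [th, th, th, et, ser_mul isProper_tri isProper_tri,
    ser_mul (isProper_tri.add isProper_tri) isProper_tri,
    ser_mul ((isProper_tri.add isProper_tri).add isProper_tri) isProper_pentagonal]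
  simp only [AddMonoidAlgebra.single_mul_single]
  unfold quadDeg
  congr 1
  funext v
  congr 1
  · simp [quadExp]
  · simp only [quadSign]; ring

/-- The three-term identity: for `f, g, h = θ(x), θ(y), θ(x + y)` one has
`η (f'' g h + f g'' h + f g h'' + 2 f' g' h - 2 f' g h' - 2 f g' h') = η'' f g h`.

Both sides are sums over four summation variables, and their difference has the extra factor
`w ^ 2 - (6 p - 1) ^ 2` with `w = (2i+1) + (2j+1) - (2k+1)`, which `quadSwap` turns into its
negative. -/
theorem three_term (x y : G) :
    et G 0 * (th 2 x * th 0 y * th 0 (x + y) + th 0 x * th 2 y * th 0 (x + y) +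
        th 0 x * th 0 y * th 2 (x + y) + 2 * (th 1 x * th 1 y * th 0 (x + y)) -
        2 * (th 1 x * th 0 y * th 1 (x + y)) - 2 * (th 0 x * th 1 y * th 1 (x + y))) =
      et G 2 * (th 0 x * th 0 y * th 0 (x + y)) := by
  have H := th_mul_th_mul_th_mul_et x y
  let Φ (c : Quad → ℤ) : PowerSeries (AddMonoidAlgebra ℤ G) :=
    ser quadDeg fun v => AddMonoidAlgebra.single (quadExp x y v) (quadSign v * c v)
  have hadd (c c' : Quad → ℤ) : Φ c + Φ c' = Φ fun v => c v + c' v := by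
    simp only [Φ, ser_add _ isProper_quadDeg, mul_add, AddMonoidAlgebra.single_add]
  have hsub (c c' : Quad → ℤ) : Φ c - Φ c' = Φ fun v => c v - c' v := by
    simp only [Φ, ser_sub _ isProper_quadDeg, mul_sub, AddMonoidAlgebra.single_sub]
  have H' (a b c d : ℕ) : th a x * th b y * th c (x + y) * et G d = Φ fun v =>
      (2 * v.1.1.1 + 1) ^ a * (2 * v.1.1.2 + 1) ^ b * (2 * v.1.2 + 1) ^ c * (6 * v.2 - 1) ^ d :=
    H a b c d
  rw [← sub_eq_zero]
  have e : et G 0 * (th 2 x * th 0 y * th 0 (x + y) + th 0 x * th 2 y * th 0 (x + y) +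
        th 0 x * th 0 y * th 2 (x + y) + 2 * (th 1 x * th 1 y * th 0 (x + y)) -
        2 * (th 1 x * th 0 y * th 1 (x + y)) - 2 * (th 0 x * th 1 y * th 1 (x + y))) -
      et G 2 * (th 0 x * th 0 y * th 0 (x + y)) =
      th 2 x * th 0 y * th 0 (x + y) * et G 0 + th 0 x * th 2 y * th 0 (x + y) * et G 0 +
      th 0 x * th 0 y * th 2 (x + y) * et G 0 + th 1 x * th 1 y * th 0 (x + y) * et G 0 +
      th 1 x * th 1 y * th 0 (x + y) * et G 0 - th 1 x * th 0 y * th 1 (x + y) * et G 0 -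
      th 1 x * th 0 y * th 1 (x + y) * et G 0 - th 0 x * th 1 y * th 1 (x + y) * et G 0 -
      th 0 x * th 1 y * th 1 (x + y) * et G 0 - th 0 x * th 0 y * th 0 (x + y) * et G 2 := by ring
  rw [e]
  simp only [H', hadd, hsub]
  refine ser_eq_zero_of_involution isProper_quadDeg _ quadSwap quadSwap_involutive
    quadDeg_quadSwap fun v => ?_
  rw [quadExp_quadSwap, ← AddMonoidAlgebra.single_neg]
  congr 1
  linear_combination quadSign_mul_quadSwap v

end ThetaSeries

/-! ### Derivations and heat equations -/

section Heat

open PowerSeries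

variable {G : Type*} [AddCommGroup G]

/-- The additive map underlying `expDer`. -/
noncomputable def expDerHom (l : G →+ ℤ) : AddMonoidAlgebra ℤ G →+ AddMonoidAlgebra ℤ G :=
  AddMonoidHom.mk' (fun x => .ofCoeff (Finsupp.onFinset x.coeff.support
    (fun g => l g * x.coeff g) fun g hg => by simpa using right_ne_zero_of_mul hg))
    fun x y => by ext; simp [mul_add]

theorem coeff_expDerHom (l : G →+ ℤ) (x : AddMonoidAlgebra ℤ G) (g : G) :
    (expDerHom l x).coeff g = l g * x.coeff g := rfl

theorem expDerHom_single (l : G →+ ℤ) (g : G) (r : ℤ) :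
    expDerHom l (AddMonoidAlgebra.single g r) = AddMonoidAlgebra.single g (l g * r) := by
  ext g'
  rw [coeff_expDerHom]
  by_cases hg : g = g'
  · subst hg; simp
  · simp [hg]

/-- The derivation `e(g) ↦ l(g) e(g)` of the group ring of `G`. -/
noncomputable def expDer (l : G →+ ℤ) :
    Derivation ℤ (AddMonoidAlgebra ℤ G) (AddMonoidAlgebra ℤ G) :=
  Derivation.mk' (expDerHom l).toIntLinearMap (by
    intro x y
    simp only [AddMonoidHom.coe_toIntLinearMap, smul_eq_mul]
    induction x using AddMonoidAlgebra.induction_linear with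
    | zero => simp
    | add x x' hx hx' => rw [add_mul, map_add, hx, hx', map_add]; ring
    | single g r =>
      induction y using AddMonoidAlgebra.induction_linear with
      | zero => simp
      | add y y' hy hy' => rw [mul_add, map_add, hy, hy', map_add]; ring
      | single g' r' =>
        simp only [AddMonoidAlgebra.single_mul_single, expDerHom_single]
        rw [add_comm g' g, ← AddMonoidAlgebra.single_add]
        congr 1
        rw [map_add]; ring)

theorem coeff_expDer (l : G →+ ℤ) (x : AddMonoidAlgebra ℤ G) (g : G) :
    (expDer l x).coeff g = l g * x.coeff g := rfl

theorem expDer_single (l : G →+ ℤ) (g : G) (r : ℤ) :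
    expDer l (AddMonoidAlgebra.single g r) = (l g) • AddMonoidAlgebra.single g r := by
  ext g'
  rw [coeff_expDer]
  by_cases hg : g = g'
  · subst hg; simp
  · simp [hg]

/-- The additive map underlying `der`. -/
noncomputable def derHom (l : G →+ ℤ) :
    PowerSeries (AddMonoidAlgebra ℤ G) →+ PowerSeries (AddMonoidAlgebra ℤ G) :=
  AddMonoidHom.mk' (fun F => mk fun n => expDer l (coeff n F)) fun F F' => by ext1; simp

theorem coeff_derHom (l : G →+ ℤ) (F : PowerSeries (AddMonoidAlgebra ℤ G)) (n : ℕ) :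
    coeff n (derHom l F) = expDer l (coeff n F) :=
  coeff_mk n fun n => expDer l (coeff n F)

/-- The extension of `expDer l` to power series in `q`, acting on the coefficients. -/
noncomputable def der (l : G →+ ℤ) :
    Derivation ℤ (PowerSeries (AddMonoidAlgebra ℤ G)) (PowerSeries (AddMonoidAlgebra ℤ G)) :=
  Derivation.mk' (derHom l).toIntLinearMap (by
    intro F F'
    ext1 n
    change coeff n (derHom l (F * F')) = coeff n (F * derHom l F' + F' * derHom l F)
    simp only [coeff_derHom, coeff_mul, map_add, map_sum, Derivation.leibniz, smul_eq_mul,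
      Finset.sum_add_distrib]
    congr 1
    rw [← Finset.Nat.sum_antidiagonal_swap]
    rfl)

theorem coeff_der (l : G →+ ℤ) (F : PowerSeries (AddMonoidAlgebra ℤ G)) (n : ℕ) :
    coeff n (der l F) = expDer l (coeff n F) := coeff_derHom l F n

variable (G) in
/-- The derivation `q d/dq`. -/
noncomputable def qDer :
    Derivation ℤ (PowerSeries (AddMonoidAlgebra ℤ G)) (PowerSeries (AddMonoidAlgebra ℤ G)) :=
  ((X : PowerSeries (AddMonoidAlgebra ℤ G)) • derivative (AddMonoidAlgebra ℤ G)).restrictScalars ℤ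

theorem coeff_qDer (F : PowerSeries (AddMonoidAlgebra ℤ G)) (n : ℕ) :
    coeff n (qDer G F) = n * coeff n F := by
  change coeff n (X * derivative (AddMonoidAlgebra ℤ G) F) = _
  rcases n with _ | n
  · simp
  · rw [coeff_succ_X_mul, coeff_derivative]
    push_cast; ring

theorem der_ser {ι : Type*} (l : G →+ ℤ) {d : ι → ℕ} (hd : IsProper d)
    (c : ι → AddMonoidAlgebra ℤ G) : der l (ser d c) = ser d fun i => expDer l (c i) := by
  ext1 N
  have h1 : ∀ i, d i ≤ N → i ∈ (hd N).toFinset := fun i hi => by simpa using hi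
  rw [coeff_der, coeff_ser _ le_rfl _ h1, coeff_ser _ le_rfl _ h1, map_sum]
  exact Finset.sum_congr rfl fun i _ => by split_ifs <;> simp

theorem qDer_ser {ι : Type*} {d : ι → ℕ} (hd : IsProper d)
    (c : ι → AddMonoidAlgebra ℤ G) : qDer G (ser d c) = ser d fun i => d i * c i := by
  ext1 N
  have h1 : ∀ i, d i ≤ N → i ∈ (hd N).toFinset := fun i hi => by simpa using hi
  rw [coeff_qDer, coeff_ser _ le_rfl _ h1, coeff_ser _ le_rfl _ h1, Finset.mul_sum]
  exact Finset.sum_congr rfl fun i _ => by split_ifs with h <;> simp [h]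

theorem intCast_mul_single (n : ℤ) (g : G) (r : ℤ) :
    (n : AddMonoidAlgebra ℤ G) * AddMonoidAlgebra.single g r =
      AddMonoidAlgebra.single g (n * r) := by
  rw [← zsmul_eq_mul, AddMonoidAlgebra.smul_single, smul_eq_mul]

theorem intCast_mul_ser {ι : Type*} {d : ι → ℕ} (hd : IsProper d) (n : ℤ)
    (c : ι → AddMonoidAlgebra ℤ G) :
    (n : PowerSeries (AddMonoidAlgebra ℤ G)) * ser d c = ser d fun i => n * c i := by
  ext1 N
  have h1 : ∀ i, d i ≤ N → i ∈ (hd N).toFinset := fun i hi => by simpa using hi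
  rw [← zsmul_eq_mul, map_zsmul, coeff_ser _ le_rfl _ h1, coeff_ser _ le_rfl _ h1, Finset.smul_sum]
  exact Finset.sum_congr rfl fun i _ => by split_ifs <;> simp

theorem der_th (l : G →+ ℤ) (k : ℕ) (g : G) : der l (th k g) = (l g) • th (k + 1) g := by
  rw [th, th, der_ser l isProper_tri, zsmul_eq_mul, intCast_mul_ser isProper_tri]
  congr 1
  funext i
  rw [expDer_single, zsmul_eq_mul, intCast_mul_single, intCast_mul_single, map_zsmul]
  congr 1
  rw [smul_eq_mul]; ring

theorem der_et (l : G →+ ℤ) (k : ℕ) : der l (et G k) = 0 := by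
  rw [et, der_ser l isProper_pentagonal]
  simp only [expDer_single, map_zero, zero_smul]
  ext1 n
  simp [ser]

/-- The heat equation for `θ`, shifted by `1/8` as `th` lacks the factor `q^{1/8}`. -/
theorem qDer_th (k : ℕ) (g : G) : 8 * qDer G (th k g) = th (k + 2) g - th k g := by
  rw [th, th, qDer_ser isProper_tri, ser_sub _ isProper_tri,
    show (8 : PowerSeries (AddMonoidAlgebra ℤ G)) = ((8 : ℤ) : PowerSeries _) by norm_num,
    intCast_mul_ser isProper_tri]
  congr 1
  funext i
  rw [← Int.cast_natCast (R := AddMonoidAlgebra ℤ G), intCast_mul_single, intCast_mul_single,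
    ← AddMonoidAlgebra.single_sub]
  congr 1
  linear_combination 4 * (i.negOnePow : ℤ) * (2 * i + 1) ^ k * two_mul_tri i

/-- The heat equation for `η`. -/
theorem qDer_et (k : ℕ) : 24 * qDer G (et G k) = et G (k + 2) - et G k := by
  rw [et, et, qDer_ser isProper_pentagonal, ser_sub _ isProper_pentagonal,
    show (24 : PowerSeries (AddMonoidAlgebra ℤ G)) = ((24 : ℤ) : PowerSeries _) by norm_num,
    intCast_mul_ser isProper_pentagonal]
  congr 1
  funext p
  rw [← Int.cast_natCast (R := AddMonoidAlgebra ℤ G), intCast_mul_single, intCast_mul_single,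
    ← AddMonoidAlgebra.single_sub]
  congr 1
  linear_combination 12 * (p.negOnePow : ℤ) * (6 * p - 1) ^ k * two_mul_natCast_pentagonal p

variable (G) in
/-- For `k = 0` the series `et G k` is Mathlib's pentagonal number series; hence it is the Euler
product, and it is invertible. -/
theorem et_zero_eq : et G 0 = pentagonalSeries (AddMonoidAlgebra ℤ G) := by
  ext1 n
  rw [et, ser, coeff_mk]
  by_cases h : n ∈ Set.range pentagonal
  · obtain ⟨k, rfl⟩ := h
    rw [coeff_pentagonalSeries_pentagonal]
    simp only [pentagonal_inj, Set.mem_ofPred_eq, pow_zero, mul_one]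
    rw [finsum_eq_single _ k fun p hp => by simp [hp]]
    have h1 := intCast_mul_single k.negOnePow (0 : G) 1
    rw [mul_one, ← AddMonoidAlgebra.one_def, mul_one] at h1
    simp [← h1]
  · rw [coeff_pentagonalSeries_eq_zero _ h]
    apply finsum_mem_eq_zero_of_forall_eq_zero
    intro p hp
    exact absurd ⟨p, hp⟩ h

end Heat

/-! ### Heat equations of the theta blocks -/

section HeatBlocks

open PowerSeries

/-- Power series in `q` over the group ring of `ℤ × ℤ`; the exponential `e(i, j)` stands for
`ζ^{(i a + j b) / 2}` with indeterminate `a` and `b`. -/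
abbrev TwoVar : Type := PowerSeries (AddMonoidAlgebra ℤ (ℤ × ℤ))

/-- The derivation `e(i, j) ↦ i e(i, j)`. -/
noncomputable abbrev D₁ : Derivation ℤ TwoVar TwoVar := der (AddMonoidHom.fst ℤ ℤ)

/-- The derivation `e(i, j) ↦ j e(i, j)`. -/
noncomputable abbrev D₂ : Derivation ℤ TwoVar TwoVar := der (AddMonoidHom.snd ℤ ℤ)

theorem et_zero_ne_zero (G : Type*) [AddCommGroup G] : et G 0 ≠ 0 := by
  intro h
  have h1 := congrArg (coeff (pentagonal 0)) h
  rw [et_zero_eq, coeff_pentagonalSeries_pentagonal] at h1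
  simp at h1

/-- A solution of a heat equation is supported on the pairs `(N, (i, j))` for which
`α i² + β i j + γ j² = κ N + c`. -/
theorem support_of_heat {κ c α β γ : ℤ} {F : TwoVar}
    (h : (κ : TwoVar) * qDer _ F + c * F =
      α * D₁ (D₁ F) + β * D₁ (D₂ F) + γ * D₂ (D₂ F)) (N : ℕ) (v : ℤ × ℤ)
    (hv : (coeff N F).coeff v ≠ 0) :
    α * v.1 ^ 2 + β * (v.1 * v.2) + γ * v.2 ^ 2 = κ * N + c := by
  have h1 := congrArg (fun S => (coeff N S).coeff v) h
  simp only [← zsmul_eq_mul, map_add, map_zsmul, coeff_der, coeff_qDer,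
    AddMonoidAlgebra.coeff_add, AddMonoidAlgebra.coeff_smul, Finsupp.add_apply,
    Finsupp.smul_apply, coeff_expDer, smul_eq_mul, AddMonoidHom.coe_fst, AddMonoidHom.coe_snd] at h1
  rw [← nsmul_eq_mul, AddMonoidAlgebra.coeff_smul, Finsupp.smul_apply, nsmul_eq_mul] at h1
  apply mul_right_cancel₀ hv
  linear_combination -h1

theorem der_ofNat {G : Type*} [AddCommGroup G] (l : G →+ ℤ) (n : ℕ) [n.AtLeastTwo] :
    der l (ofNat(n)) = 0 := (der l).map_natCast n

/-- The heat equation of `θ(x) θ(y) θ(x + y) / η`. The product rule produces mixed terms for the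
pairs of roots, which are exactly those of `three_term`. -/
theorem heat_A2 {F : TwoVar} (hF : et _ 0 * F = th 0 (1, 0) * th 0 (0, 1) * th 0 (1, 1)) :
    ((24 : ℤ) : TwoVar) * qDer _ F + ((8 : ℤ) : TwoVar) * F =
      ((2 : ℤ) : TwoVar) * D₁ (D₁ F) + ((-2 : ℤ) : TwoVar) * D₁ (D₂ F) +
        ((2 : ℤ) : TwoVar) * D₂ (D₂ F) := by
  have hq := congrArg (qDer _) hF
  have h11 := congrArg (fun S => D₁ (D₁ S)) hF
  have h12 := congrArg (fun S => D₁ (D₂ S)) hF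
  have h22 := congrArg (fun S => D₂ (D₂ S)) hF
  simp only [Derivation.leibniz, map_add, der_th, der_et, smul_eq_mul,
    AddMonoidHom.coe_fst, AddMonoidHom.coe_snd,
    mul_zero, add_zero, zero_add, zero_smul, one_smul] at hq h11 h12 h22
  have ha := qDer_th 0 ((1, 0) : ℤ × ℤ)
  have hb := qDer_th 0 ((0, 1) : ℤ × ℤ)
  have hc := qDer_th 0 ((1, 1) : ℤ × ℤ)
  have he := qDer_et (G := ℤ × ℤ) 0
  have ht := three_term ((1, 0) : ℤ × ℤ) (0, 1)
  simp only [Prod.mk_add_mk, add_zero, zero_add] at ht ha hb hc he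
  apply mul_left_cancel₀ (mul_ne_zero (et_zero_ne_zero (ℤ × ℤ)) (et_zero_ne_zero (ℤ × ℤ)))
  push_cast
  generalize qDer (ℤ × ℤ) F = qF at *
  generalize qDer (ℤ × ℤ) (et (ℤ × ℤ) 0) = qE at *
  linear_combination 24 * et _ 0 * hq - 2 * et _ 0 * (h11 - h12 + h22) + ht +
    (9 * et _ 0 - et _ 2) * hF - et _ 0 * F * he + 3 * et _ 0 * (th 0 (0, 1) * th 0 (1, 1) * ha +
    th 0 (1, 0) * th 0 (1, 1) * hb + th 0 (1, 0) * th 0 (0, 1) * hc)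

/-- The heat equation of the block of `B₂`. The mixed terms of the product rule are eliminated by
`three_term` for the two relations `x + y = (x + y)` and `y + (x + y) = (x + 2y)` between the roots;
their contributions to the orthogonal pair `y`, `x + y` cancel. -/
theorem heat_B2 {F : TwoVar}
    (hF : et _ 0 ^ 2 * F = th 0 (1, 0) * th 0 (0, 1) * th 0 (1, 1) * th 0 (1, 2)) :
    ((24 : ℤ) : TwoVar) * qDer _ F + ((10 : ℤ) : TwoVar) * F =
      ((2 : ℤ) : TwoVar) * D₁ (D₁ F) + ((-2 : ℤ) : TwoVar) * D₁ (D₂ F) +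
        ((1 : ℤ) : TwoVar) * D₂ (D₂ F) := by
  rw [pow_two] at hF
  have hq := congrArg (qDer _) hF
  have h11 := congrArg (fun S => D₁ (D₁ S)) hF
  have h12 := congrArg (fun S => D₁ (D₂ S)) hF
  have h22 := congrArg (fun S => D₂ (D₂ S)) hF
  simp only [Derivation.leibniz, map_add, der_th, der_et, smul_eq_mul, zsmul_eq_mul,
    AddMonoidHom.coe_fst, AddMonoidHom.coe_snd,
    mul_zero, add_zero, zero_add, zero_smul, one_smul, der_ofNat,
    Int.cast_ofNat] at hq h11 h12 h22
  have ha := qDer_th 0 ((1, 0) : ℤ × ℤ)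
  have hb := qDer_th 0 ((0, 1) : ℤ × ℤ)
  have hc := qDer_th 0 ((1, 1) : ℤ × ℤ)
  have hd := qDer_th 0 ((1, 2) : ℤ × ℤ)
  have he := qDer_et (G := ℤ × ℤ) 0
  have ht := three_term ((1, 0) : ℤ × ℤ) (0, 1)
  have ht' := three_term ((0, 1) : ℤ × ℤ) (1, 1)
  norm_num [Prod.mk_add_mk] at ht ht' ha hb hc hd he
  apply mul_left_cancel₀ (pow_ne_zero 3 (et_zero_ne_zero (ℤ × ℤ)))
  push_cast
  generalize qDer (ℤ × ℤ) F = qF at *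
  generalize qDer (ℤ × ℤ) (et (ℤ × ℤ) 0) = qE at *
  generalize qDer (ℤ × ℤ) (th 0 (1, 0)) = qa at *
  generalize qDer (ℤ × ℤ) (th 0 (0, 1)) = qb at *
  generalize qDer (ℤ × ℤ) (th 0 (1, 1)) = qc at *
  generalize qDer (ℤ × ℤ) (th 0 (1, 2)) = qd at *
  generalize et (ℤ × ℤ) 0 = E at *
  generalize et (ℤ × ℤ) 2 = E2 at *
  linear_combination 24 * E * hq - E * (2 * h11 - 2 * h12 + h22) + th 0 (1, 2) * ht +
    th 0 (1, 0) * ht' +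
    (12 * E - 2 * E2) * hF - 2 * E ^ 2 * F * he + 3 * E *
    (th 0 (0, 1) * th 0 (1, 1) * th 0 (1, 2) * ha +
    th 0 (1, 0) * th 0 (1, 1) * th 0 (1, 2) * hb + th 0 (1, 0) * th 0 (0, 1) * th 0 (1, 2) * hc +
    th 0 (1, 0) * th 0 (0, 1) * th 0 (1, 1) * hd)

set_option maxHeartbeats 1000000 in
/-- The heat equation of the block of `G₂`. Here `three_term` is used for the triple of short
roots with weight `4`, and with weight `3` for the triple of long roots and for the three relations
between two short roots and a long one; this choice makes the coefficients at all pairs of roots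
agree with the invariant form. -/
theorem heat_G2 {F : TwoVar}
    (hF : et _ 0 ^ 4 * F = th 0 (1, 0) * th 0 (0, 1) * th 0 (1, 1) * th 0 (2, 1) * th 0 (3, 1) *
      th 0 (3, 2)) :
    ((96 : ℤ) : TwoVar) * qDer _ F + ((56 : ℤ) : TwoVar) * F =
      ((2 : ℤ) : TwoVar) * D₁ (D₁ F) + ((-6 : ℤ) : TwoVar) * D₁ (D₂ F) +
        ((6 : ℤ) : TwoVar) * D₂ (D₂ F) := by
  rw [show et (ℤ × ℤ) 0 ^ 4 = et _ 0 * et _ 0 * et _ 0 * et _ 0 by ring] at hF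
  have hq := congrArg (qDer _) hF
  have h11 := congrArg (fun S => D₁ (D₁ S)) hF
  have h12 := congrArg (fun S => D₁ (D₂ S)) hF
  have h22 := congrArg (fun S => D₂ (D₂ S)) hF
  simp only [Derivation.leibniz, map_add, der_th, der_et, smul_eq_mul, zsmul_eq_mul,
    AddMonoidHom.coe_fst, AddMonoidHom.coe_snd,
    mul_zero, add_zero, zero_add, zero_smul, one_smul, der_ofNat,
    Int.cast_ofNat] at hq h11 h12 h22
  have hs₁ := qDer_th 0 ((1, 0) : ℤ × ℤ)
  have hs₂ := qDer_th 0 ((1, 1) : ℤ × ℤ)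
  have hs₃ := qDer_th 0 ((2, 1) : ℤ × ℤ)
  have hl₁ := qDer_th 0 ((0, 1) : ℤ × ℤ)
  have hl₂ := qDer_th 0 ((3, 1) : ℤ × ℤ)
  have hl₃ := qDer_th 0 ((3, 2) : ℤ × ℤ)
  have he := qDer_et (G := ℤ × ℤ) 0
  have hsss := three_term ((1, 0) : ℤ × ℤ) (1, 1)
  have hlll := three_term ((0, 1) : ℤ × ℤ) (3, 1)
  have h₂ := three_term ((1, 0) : ℤ × ℤ) (2, 1)
  have h₃ := three_term ((1, 1) : ℤ × ℤ) (2, 1)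
  have h₁ := three_term ((1, 0) : ℤ × ℤ) (0, 1)
  norm_num [Prod.mk_add_mk] at hsss hlll h₁ h₂ h₃ hs₁ hs₂ hs₃ hl₁ hl₂ hl₃ he
  apply mul_left_cancel₀ (pow_ne_zero 5 (et_zero_ne_zero (ℤ × ℤ)))
  push_cast
  generalize qDer (ℤ × ℤ) F = qF at *
  generalize qDer (ℤ × ℤ) (et (ℤ × ℤ) 0) = qE at *
  generalize D₁ (D₁ F) = F11 at *
  generalize D₁ (D₂ F) = F12 at *
  generalize D₂ (D₂ F) = F22 at *
  generalize et (ℤ × ℤ) 0 = E at *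
  generalize et (ℤ × ℤ) 2 = E2 at *
  generalize qDer (ℤ × ℤ) (th 0 (1, 0)) = qs₁ at *
  generalize qDer (ℤ × ℤ) (th 0 (1, 1)) = qs₂ at *
  generalize qDer (ℤ × ℤ) (th 0 (2, 1)) = qs₃ at *
  generalize qDer (ℤ × ℤ) (th 0 (0, 1)) = ql₁ at *
  generalize qDer (ℤ × ℤ) (th 0 (3, 1)) = ql₂ at *
  generalize qDer (ℤ × ℤ) (th 0 (3, 2)) = ql₃ at *
  generalize (th 0 (1, 0) : TwoVar) = s₁ at *
  generalize (th 0 (1, 1) : TwoVar) = s₂ at *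
  generalize (th 0 (2, 1) : TwoVar) = s₃ at *
  generalize (th 0 (0, 1) : TwoVar) = l₁ at *
  generalize (th 0 (3, 1) : TwoVar) = l₂ at *
  generalize (th 0 (3, 2) : TwoVar) = l₃ at *
  linear_combination 96 * E * hq - E * (2 * h11 - 6 * h12 + 6 * h22) + 4 * (l₁ * l₂ * l₃) * hsss +
    3 * (s₁ * s₂ * s₃) * hlll + 3 * (s₂ * l₁ * l₃) * h₂ + 3 * (s₁ * l₁ * l₂) * h₃ +
    3 * (s₃ * l₂ * l₃) * h₁ + (72 * E - 16 * E2) * hF - 16 * E ^ 4 * F * he + 12 * E *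
    (s₂ * s₃ * l₁ * l₂ * l₃ * hs₁ + s₁ * s₃ * l₁ * l₂ * l₃ * hs₂ + s₁ * s₂ * l₁ * l₂ * l₃ * hs₃ +
      s₁ * s₂ * s₃ * l₂ * l₃ * hl₁ + s₁ * s₂ * s₃ * l₁ * l₃ * hl₂ + s₁ * s₂ * s₃ * l₁ * l₂ * hl₃)

/-- The derivation `T d/dT`. -/
noncomputable abbrev D₀ : Derivation ℤ QSeries QSeries := der (AddMonoidHom.id ℤ)

/-- The heat equation of `θ*`, which is `η θ(2z) / θ(z)`, from `three_term` for `x = y`. -/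
theorem heat_quintuple {F : QSeries} (hF : th 0 (1 : ℤ) * F = et ℤ 0 * th 0 (2 : ℤ))
    (h0 : th 0 (1 : ℤ) ≠ 0) : 24 * qDer ℤ F + F = D₀ (D₀ F) := by
  have hq := congrArg (qDer _) hF
  have h1 := congrArg D₀ hF
  have h11 := congrArg D₀ h1
  simp only [Derivation.leibniz, map_add, der_th, der_et, smul_eq_mul, zsmul_eq_mul,
    AddMonoidHom.id_apply, mul_zero, add_zero, one_smul, der_ofNat, Int.cast_ofNat] at hq h1 h11
  have ha := qDer_th 0 (1 : ℤ)
  have hb := qDer_th 0 (2 : ℤ)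
  have he := qDer_et (G := ℤ) 0
  have ht := three_term (1 : ℤ) 1
  norm_num at ht ha hb he
  apply mul_left_cancel₀ (pow_ne_zero 3 h0)
  generalize qDer ℤ F = qF at *
  generalize qDer ℤ (et ℤ 0) = qE at *
  generalize D₀ (D₀ F) = F11 at *
  generalize D₀ F = F1 at *
  generalize et ℤ 0 = E at *
  generalize et ℤ 2 = E2 at *
  generalize qDer ℤ (th 0 (1 : ℤ)) = qa at *
  generalize qDer ℤ (th 0 (2 : ℤ)) = qb at *
  generalize (th 0 (1 : ℤ) : QSeries) = f at *
  generalize (th 0 (2 : ℤ) : QSeries) = h at *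
  generalize (th (0 + 1) (1 : ℤ) : QSeries) = f1 at *
  linear_combination 24 * f ^ 2 * hq - f ^ 2 * h11 + 2 * f * f1 * h1 - 3 * f ^ 2 * F * ha +
    3 * f ^ 2 * E * hb + f ^ 2 * h * he - ht +
    (4 * f ^ 2 - 2 * f * th 2 1 - 2 * f1 ^ 2) * hF

end HeatBlocks

/-! ### Comparison of products and series -/

section Products

open PowerSeries

theorem sum_Ico_int {M : Type*} [AddCommMonoid M] (f : ℤ → M) (K : ℕ) :
    ∑ i ∈ Finset.Ico (-K : ℤ) K, f i = ∑ i ∈ Finset.range K, (f i + f (-i - 1)) := by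
  induction K with
  | zero => simp
  | succ K ih =>
    rw [Finset.sum_range_succ, ← ih]
    have h : Finset.Ico (-(K + 1 : ℕ) : ℤ) (K + 1 : ℕ) =
        insert (-K - 1 : ℤ) (insert (K : ℤ) (Finset.Ico (-K : ℤ) K)) := by
      ext i; simp only [Finset.mem_Ico, Finset.mem_insert]; push_cast; omega
    rw [h, Finset.sum_insert, Finset.sum_insert]
    · abel
    · simp
    · simp only [Finset.mem_Ico, Finset.mem_insert]; omega

/-- The coefficient of `th 0 g`, after pairing the indices `i` and `-i - 1`. -/
theorem coeff_th_zero {G : Type*} [AddCommGroup G] (g : G) (N : ℕ) :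
    coeff N (th 0 g) = ∑ i ∈ Finset.range (N + 1), if i * (i + 1) / 2 = N then
      (-1) ^ i * (AddMonoidAlgebra.single ((2 * i + 1 : ℤ) • g) (1 : ℤ) -
        AddMonoidAlgebra.single (-((2 * i + 1 : ℤ) • g)) 1) else 0 := by
  rw [th, coeff_ser _ le_rfl (Finset.Ico (-(N + 1 : ℕ) : ℤ) (N + 1 : ℕ)), sum_Ico_int]
  · refine Finset.sum_congr rfl fun i _ => ?_
    have h1 : tri (i : ℤ) = i * (i + 1) / 2 := by
      rw [tri]; norm_cast
    have h2 : tri (-(i : ℤ) - 1) = i * (i + 1) / 2 := by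
      rw [← h1]
      have h := two_mul_tri (i : ℤ)
      have h' := two_mul_tri (-(i : ℤ) - 1)
      have : (tri (i : ℤ) : ℤ) = tri (-(i : ℤ) - 1) := by linarith
      exact_mod_cast this.symm
    rw [h1, h2]
    split_ifs
    · have e1 : (2 * (-(i : ℤ) - 1) + 1) • g = -((2 * i + 1 : ℤ) • g) := by module
      have e2 := intCast_mul_single ((i : ℤ).negOnePow) ((2 * i + 1 : ℤ) • g) 1
      have e3 := intCast_mul_single ((i : ℤ).negOnePow) (-((2 * i + 1 : ℤ) • g)) 1
      have e4 : (-(i : ℤ) - 1).negOnePow = -(i : ℤ).negOnePow := by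
        rw [show -(i : ℤ) - 1 = -(i + 1) by ring, Int.negOnePow_neg, Int.negOnePow_succ]
      have e5 : (((i : ℤ).negOnePow : ℤ) : AddMonoidAlgebra ℤ G) = (-1) ^ i := by simp
      rw [e5] at e2 e3
      rw [mul_sub ((-1) ^ i : AddMonoidAlgebra ℤ G), e2, e3, e1, e4]
      simp [sub_eq_add_neg]
    · simp
  · intro i hi
    have h := two_mul_tri i
    zify at hi
    rw [Finset.mem_Ico]
    push_cast
    constructor <;> nlinarith

theorem th_zero_zero (G : Type*) [AddCommGroup G] : th 0 (0 : G) = 0 := by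
  ext1 N
  simp [coeff_th_zero]

theorem X_pow_dvd_qProd_sub (f : ℕ → QSeries)
    (hf : ∀ n, X ^ (n + 1) ∣ f (n + 1) - 1) {N n : ℕ} (hn : N ≤ n) :
    X ^ (N + 1) ∣ qProd f - ∏ k ∈ Finset.range n, f (k + 1) := by
  rw [X_pow_dvd_iff]
  intro m hm
  rw [map_sub, coeff_qProd f hf, sub_eq_zero]
  have h1 : Finset.range m ⊆ Finset.range n := Finset.range_subset_range.2 (by omega)
  rw [← Finset.prod_sdiff h1, mul_comm, coeff_mul_of_dvd _ _ le_rfl]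
  exact X_pow_dvd_prod_sub_one f hf m _ fun k hk => by
    simpa using (Finset.mem_sdiff.1 hk).2

theorem coeff_congr {R : Type*} [CommRing R] {A B : PowerSeries R} {N : ℕ}
    (h : X ^ (N + 1) ∣ A - B) : coeff N A = coeff N B := by
  have := X_pow_dvd_iff.1 h N (by omega)
  rwa [map_sub, sub_eq_zero] at this

/-- The factors of the product `θ(mz)`. -/
noncomputable def thetaFac (m : ℤ) (n : ℕ) : QSeries :=
  (1 - X ^ n) * (1 - cst (zeta m) * X ^ n) * (1 - cst (zeta (-m)) * X ^ n)

theorem X_pow_dvd_thetaFac (m : ℤ) (n : ℕ) : X ^ (n + 1) ∣ thetaFac m (n + 1) - 1 :=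
  theta_factor _ _ _

/-- The factors of the product `θ*(mz)`. -/
noncomputable def thetaStarFac (m : ℤ) (n : ℕ) : QSeries :=
  (1 - X ^ n) * (1 + cst (zeta m) * X ^ n) * (1 + cst (zeta (-m)) * X ^ n) *
    (1 - cst (zeta (2 * m)) * X ^ (2 * n - 1)) * (1 - cst (zeta (-(2 * m))) * X ^ (2 * n - 1))

theorem X_pow_dvd_thetaStarFac (m : ℤ) (n : ℕ) : X ^ (n + 1) ∣ thetaStarFac m (n + 1) - 1 :=
  thetaStar_factor _ _ _ _ _

/-- The factors of the product `η`. -/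
noncomputable def etaFac (n : ℕ) : QSeries := 1 - X ^ n

theorem X_pow_dvd_etaFac (n : ℕ) : X ^ (n + 1) ∣ etaFac (n + 1) - 1 := eulerProd_factor n

/-- The product and the sum defining `θ` agree, by the Jacobi triple product. -/
theorem th_zero_eq (m : ℤ) : th 0 m = C (zetaHalf m - zetaHalf (-m)) * qProd (thetaFac m) := by
  symm
  ext1 N
  have h0 := (X_pow_dvd_qProd_sub _ (X_pow_dvd_thetaFac m)
    (show N ≤ 2 * N by omega)).mul_left (C (zetaHalf m - zetaHalf (-m)))
  rw [mul_sub] at h0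
  rw [coeff_congr h0]
  have hxy : zetaHalf m * zetaHalf (-m) = 1 := by
    rw [zetaHalf, zetaHalf, ← LaurentPolynomial.T_add, add_neg_cancel, LaurentPolynomial.T_zero]
  have h2 := jacobi_coeff (zetaHalf m) (zetaHalf (-m)) hxy N (2 * N) le_rfl
  have h3 : zetaHalf m ^ 2 = zeta m := LaurentPolynomial.T_pow _ _
  have h4 : zetaHalf (-m) ^ 2 = zeta (-m) := LaurentPolynomial.T_pow _ _
  rw [h3, h4] at h2
  refine h2.trans ?_
  rw [coeff_th_zero]
  refine Finset.sum_congr rfl fun i _ => ?_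
  have h5 : zetaHalf m ^ (2 * i + 1) = AddMonoidAlgebra.single ((2 * i + 1 : ℤ) • m) 1 := by
    refine (LaurentPolynomial.T_pow _ _).trans ?_
    rw [LaurentPolynomial.T]; push_cast; rfl
  have h6 : zetaHalf (-m) ^ (2 * i + 1) =
      AddMonoidAlgebra.single (-((2 * i + 1 : ℤ) • m)) 1 := by
    refine (LaurentPolynomial.T_pow _ _).trans ?_
    rw [LaurentPolynomial.T, ← smul_neg]; push_cast; rfl
  rw [h5, h6]

theorem const_eq (c : ZetaRing) : const c = ofQSeries (C c) := (HahnSeries.ofPowerSeries_C _).symm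

theorem theta_eq (m : ℤ) : theta m = qPow (1 / 8) * ofQSeries (th 0 m) := by
  rw [theta, mul_assoc, const_eq, ← map_mul, th_zero_eq]; rfl

theorem eulerProd_eq : eulerProd = et ℤ 0 := by
  let _ : TopologicalSpace ZetaRing := ⊥
  have _ : DiscreteTopology ZetaRing := ⟨rfl⟩
  rw [et_zero_eq]
  exact WithPiTopology.tprod_one_sub_X_pow ZetaRing

/-- The power series part of `thetaStar`. -/
noncomputable def thetaStarSeries (m : ℤ) : QSeries :=
  C (zetaHalf m + zetaHalf (-m)) * qProd (thetaStarFac m)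

theorem thetaStar_eq (m : ℤ) : thetaStar m = qPow (1 / 24) * ofQSeries (thetaStarSeries m) := by
  rw [thetaStar, mul_assoc, const_eq, ← map_mul, thetaStarSeries]; rfl

theorem prod_range_two_mul {M : Type*} [CommMonoid M] (f : ℕ → M) (n : ℕ) :
    ∏ k ∈ Finset.range (2 * n), f k = ∏ k ∈ Finset.range n, (f (2 * k) * f (2 * k + 1)) := by
  induction n with
  | zero => simp
  | succ n ih =>
    rw [show 2 * (n + 1) = 2 * n + 1 + 1 by ring, Finset.prod_range_succ, Finset.prod_range_succ,
      ih, Finset.prod_range_succ, mul_assoc]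

theorem mk_qProd (f : ℕ → QSeries) (hf : ∀ n, X ^ (n + 1) ∣ f (n + 1) - 1) {N n : ℕ}
    (hn : N ≤ n) :
    Ideal.Quotient.mk (Ideal.span {(X : QSeries) ^ (N + 1)}) (qProd f) =
      Ideal.Quotient.mk _ (∏ k ∈ Finset.range n, f (k + 1)) := by
  rw [Ideal.Quotient.eq, Ideal.mem_span_singleton]
  exact X_pow_dvd_qProd_sub f hf hn

theorem eq_of_mk_eq {A B : QSeries} (h : ∀ N, Ideal.Quotient.mk
    (Ideal.span {(X : QSeries) ^ (N + 1)}) A = Ideal.Quotient.mk _ B) : A = B := by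
  ext1 N
  have h1 := h N
  rw [Ideal.Quotient.eq, Ideal.mem_span_singleton] at h1
  exact coeff_congr h1

/-- The finite form of `θ(z) θ*(z) = η θ(2z)`: for even `n`, the factors of index `n` of `θ(2z)` and
`η` combine to squares of those of index `n / 2`. -/
theorem prod_thetaFac_mul_prod_thetaStarFac (m : ℤ) (N : ℕ) :
    (∏ k ∈ Finset.range N, thetaFac m (k + 1)) * (∏ k ∈ Finset.range N, thetaStarFac m (k + 1)) *
        ∏ k ∈ Finset.range (2 * N), etaFac (k + 1) =
      (∏ k ∈ Finset.range N, etaFac (k + 1)) * (∏ k ∈ Finset.range N, etaFac (k + 1)) *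
        ∏ k ∈ Finset.range (2 * N), thetaFac (2 * m) (k + 1) := by
  have c2 : ∀ m : ℤ, cst (zeta (2 * m)) = cst (zeta m) * cst (zeta m) := fun m => by
    rw [← map_mul, zeta, zeta, ← LaurentPolynomial.T_add]; congr 2; ring
  have c3 : cst (zeta (-(2 * m))) = cst (zeta (-m)) * cst (zeta (-m)) := by
    rw [← c2]; congr 2; ring
  rw [prod_range_two_mul, prod_range_two_mul]
  simp only [← Finset.prod_mul_distrib]
  refine Finset.prod_congr rfl fun k _ => ?_
  simp only [thetaFac, thetaStarFac, etaFac, c3, c2, show 2 * (k + 1) - 1 = 2 * k + 1 by omega]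
  generalize cst (zeta m) = z
  generalize cst (zeta (-m)) = w
  ring

/-- The relation `θ(z) θ*(z) = η θ(2z)`. -/
theorem th_mul_thetaStarSeries (m : ℤ) :
    th 0 m * thetaStarSeries m = et ℤ 0 * th 0 (2 * m) := by
  have c1 : (zetaHalf m - zetaHalf (-m)) * (zetaHalf m + zetaHalf (-m)) =
      zetaHalf (2 * m) - zetaHalf (-(2 * m)) := by
    have e1 : zetaHalf m * zetaHalf m = zetaHalf (2 * m) := by
      rw [zetaHalf, zetaHalf, ← LaurentPolynomial.T_add]; congr 1; ring
    have e2 : zetaHalf (-m) * zetaHalf (-m) = zetaHalf (-(2 * m)) := by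
      rw [zetaHalf, zetaHalf, ← LaurentPolynomial.T_add]; congr 1; ring
    rw [← e1, ← e2]; ring
  have h : qProd (thetaFac m) * qProd (thetaStarFac m) * qProd etaFac =
      qProd etaFac * qProd etaFac * qProd (thetaFac (2 * m)) := by
    apply eq_of_mk_eq
    intro N
    rw [map_mul, map_mul, map_mul, map_mul]
    nth_rewrite 1 [mk_qProd _ X_pow_dvd_etaFac (show N ≤ 2 * N by omega)]
    rw [mk_qProd _ X_pow_dvd_etaFac (le_refl N), mk_qProd _ (X_pow_dvd_thetaFac _) (le_refl N),
      mk_qProd _ (X_pow_dvd_thetaStarFac _) (le_refl N),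
      mk_qProd _ (X_pow_dvd_thetaFac _) (show N ≤ 2 * N by omega),
      ← map_mul, ← map_mul, ← map_mul, ← map_mul, prod_thetaFac_mul_prod_thetaStarFac]
  have hE : qProd etaFac = et ℤ 0 := eulerProd_eq
  apply mul_right_cancel₀ (et_zero_ne_zero ℤ)
  rw [hE] at h
  rw [th_zero_eq, th_zero_eq, thetaStarSeries, ← c1, map_mul]
  linear_combination C (zetaHalf m - zetaHalf (-m)) * C (zetaHalf m + zetaHalf (-m)) * h

/-- Substituting powers of `ζ` in the products. -/
theorem map_qProd {f g : ℕ → QSeries} (φ : ZetaRing →+* ZetaRing)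
    (hf : ∀ n, X ^ (n + 1) ∣ f (n + 1) - 1) (h : ∀ n, PowerSeries.map φ (f n) = g n) :
    PowerSeries.map φ (qProd f) = qProd g := by
  have hg : ∀ n, X ^ (n + 1) ∣ g (n + 1) - 1 := fun n => by
    have := map_dvd (PowerSeries.map φ) (hf n)
    simpa [h] using this
  ext1 N
  rw [coeff_map, coeff_qProd f hf, coeff_qProd g hg, ← coeff_map, map_prod]
  simp only [h]

/-- The substitution `T ↦ T ^ m`. -/
noncomputable def powMap (m : ℤ) : ZetaRing →+* ZetaRing :=
  AddMonoidAlgebra.mapDomainRingHom ℤ (zmultiplesHom ℤ m)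

theorem powMap_T (m n : ℤ) : powMap m (LaurentPolynomial.T n) = LaurentPolynomial.T (n * m) := by
  rw [LaurentPolynomial.T, LaurentPolynomial.T, ← smul_eq_mul]
  exact AddMonoidAlgebra.mapDomain_single

theorem map_thetaStarSeries (m : ℤ) :
    PowerSeries.map (powMap m) (thetaStarSeries 1) = thetaStarSeries m := by
  rw [thetaStarSeries, thetaStarSeries, map_mul]
  have hz : ∀ n, PowerSeries.map (powMap m) (cst (zeta n)) = cst (zeta (n * m)) := fun n => by
    rw [cst, map_C, zeta, powMap_T, zeta, mul_assoc]
  congr 1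
  · rw [map_C, map_add, zetaHalf, zetaHalf, powMap_T, powMap_T]
    simp [zetaHalf]
  · refine map_qProd _ (X_pow_dvd_thetaStarFac _) fun n => ?_
    simp only [thetaStarFac, map_mul, map_sub, map_add, map_one, map_pow, map_X, hz]
    simp

theorem th_one_ne_zero : th 0 (1 : ℤ) ≠ 0 := by
  intro h
  have h1 := congrArg (fun S => (coeff 0 S).coeff 1) h
  simp [coeff_th_zero] at h1

/-- The exponents of `q` in `θ*` are of the form `n²/24`. This follows from the heat equation for
`m = 1`, where they are tied to the exponents of `ζ`; the general case is a substitution. -/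
theorem sq_of_coeff_thetaStarSeries_ne_zero {N : ℕ} {m : ℤ}
    (h : coeff N (thetaStarSeries m) ≠ 0) : ∃ n : ℤ, n ^ 2 = 24 * N + 1 := by
  have h1 : coeff N (thetaStarSeries 1) ≠ 0 := by
    intro h0
    rw [← map_thetaStarSeries, coeff_map, h0, map_zero] at h
    exact h rfl
  have h2 : ∃ n, (coeff N (thetaStarSeries 1)).coeff n ≠ 0 := by
    by_contra! h3
    exact h1 (by ext n; simp [h3])
  obtain ⟨n, hn⟩ := h2
  refine ⟨n, ?_⟩
  have hh := heat_quintuple (th_mul_thetaStarSeries 1) th_one_ne_zero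
  have h4 := congrArg (fun S => (coeff N S).coeff n) hh
  simp only [map_add, coeff_der, AddMonoidAlgebra.coeff_add, Finsupp.add_apply, coeff_expDer,
    AddMonoidHom.id_apply] at h4
  rw [show (24 : QSeries) = ((24 : ℤ) : QSeries) by norm_num, ← zsmul_eq_mul, map_zsmul, coeff_qDer,
    AddMonoidAlgebra.coeff_smul, Finsupp.smul_apply,
    ← nsmul_eq_mul, AddMonoidAlgebra.coeff_smul, Finsupp.smul_apply, nsmul_eq_mul] at h4
  simp only [smul_eq_mul] at h4
  apply mul_right_cancel₀ hn
  linear_combination -h4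

end Products

/-! ### Divisibility by the cyclotomic polynomial -/

section CyclotomicDivisibility

open PowerSeries

/-- The powers `ζ^{u/2}` and `ζ^{v/2}` agree modulo `Φ_ℓ(ζ)`, if `u` and `v` are congruent modulo
`2 ℓ`: the variable is `ζ^{1/2}`, so that `ζ^ℓ = 1` gives the period `2 ℓ`. -/
theorem cyclotomicZeta_dvd (ℓ : ℕ) {u v : ℤ} (h : (2 * ℓ : ℤ) ∣ u - v) :
    cyclotomicZeta ℓ ∣ LaurentPolynomial.T u - LaurentPolynomial.T v := by
  have h1 : cyclotomicZeta ℓ ∣ LaurentPolynomial.T (2 * ℓ : ℤ) - 1 := by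
    have h2 := map_dvd (Polynomial.aeval (zeta 1)) (Polynomial.cyclotomic.dvd_X_pow_sub_one ℓ ℤ)
    have h3 : zeta 1 ^ ℓ = LaurentPolynomial.T (2 * ℓ : ℤ) := by
      rw [zeta, LaurentPolynomial.T_pow]; congr 1; ring
    rw [map_sub, map_pow, Polynomial.aeval_X, map_one, h3] at h2
    exact h2
  have h4 : ∀ n : ℕ, cyclotomicZeta ℓ ∣ LaurentPolynomial.T (n * (2 * ℓ) : ℤ) - 1 := fun n => by
    rw [← LaurentPolynomial.T_pow]
    exact h1.trans
      (by simpa using sub_dvd_pow_sub_pow (LaurentPolynomial.T (2 * ℓ : ℤ) : ZetaRing) 1 n)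
  obtain ⟨c, hc⟩ := h
  obtain ⟨n, rfl | rfl⟩ := c.eq_nat_or_neg
  · rw [show u = v + n * (2 * ℓ) by linarith, LaurentPolynomial.T_add]
    have : LaurentPolynomial.T v * LaurentPolynomial.T (n * (2 * ℓ) : ℤ) - LaurentPolynomial.T v =
      LaurentPolynomial.T v * (LaurentPolynomial.T (n * (2 * ℓ) : ℤ) - 1 : ZetaRing) := by ring
    rw [this]
    exact (h4 n).mul_left _
  · rw [show v = u + n * (2 * ℓ) by linarith, LaurentPolynomial.T_add]
    have : LaurentPolynomial.T u - LaurentPolynomial.T u * LaurentPolynomial.T (n * (2 * ℓ) : ℤ) =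
      -LaurentPolynomial.T u * (LaurentPolynomial.T (n * (2 * ℓ) : ℤ) - 1 : ZetaRing) := by ring
    rw [this]
    exact (h4 n).mul_left _

/-- The homomorphism `(i, j) ↦ a i + b j`. -/
def pairing (a b : ℤ) : ℤ × ℤ →+ ℤ :=
  (zmultiplesHom ℤ a).coprod (zmultiplesHom ℤ b)

theorem pairing_apply (a b : ℤ) (v : ℤ × ℤ) : pairing a b v = v.1 * a + v.2 * b := by
  simp [pairing]

/-- The specialization `e(i, j) ↦ ζ^{(i a + j b)/2}`. -/
noncomputable def spec (a b : ℤ) : AddMonoidAlgebra ℤ (ℤ × ℤ) →+* ZetaRing :=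
  AddMonoidAlgebra.mapDomainRingHom ℤ (pairing a b)

theorem spec_single (a b : ℤ) (v : ℤ × ℤ) (r : ℤ) :
    spec a b (AddMonoidAlgebra.single v r) =
      (r : ZetaRing) * LaurentPolynomial.T (v.1 * a + v.2 * b) := by
  refine (AddMonoidAlgebra.mapDomain_single).trans ?_
  rw [pairing_apply, LaurentPolynomial.T, intCast_mul_single, mul_one]

theorem map_spec_th (a b : ℤ) (k : ℕ) (v : ℤ × ℤ) :
    PowerSeries.map (spec a b) (th k v) = th k (v.1 * a + v.2 * b) := by
  rw [th, th, map_ser _ isProper_tri]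
  congr 1
  funext i
  refine (AddMonoidAlgebra.mapDomain_single).trans ?_
  congr 1
  change pairing a b _ = _
  rw [map_zsmul, pairing_apply]

theorem map_spec_et (a b : ℤ) (k : ℕ) :
    PowerSeries.map (spec a b) (et (ℤ × ℤ) k) = et ℤ k := by
  rw [et, et, map_ser _ isProper_pentagonal]
  congr 1
  funext i
  refine (AddMonoidAlgebra.mapDomain_single).trans ?_
  congr 1
  exact map_zero _

/-- If all exponents occurring in `C` are congruent to each other modulo `2 ℓ`, and the
coefficients of `C` add up to zero, then `C` specializes to a multiple of `Φ_ℓ(ζ)`. -/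
theorem cyclotomicZeta_dvd_spec (ℓ : ℕ) (C : AddMonoidAlgebra ℤ (ℤ × ℤ)) (a b κ₁ κ₂ : ℤ)
    (hC : ∀ v, C.coeff v ≠ 0 → (2 * ℓ : ℤ) ∣ v.1 - κ₁ ∧ (2 * ℓ : ℤ) ∣ v.2 - κ₂)
    (h0 : spec 0 0 C = 0) : cyclotomicZeta ℓ ∣ spec a b C := by
  have h : ∀ a b, spec a b C = ∑ v ∈ C.coeff.support,
      (C.coeff v : ZetaRing) * LaurentPolynomial.T (v.1 * a + v.2 * b) := fun a b => by
    conv_lhs => rw [← AddMonoidAlgebra.sum_coeff_single C, Finsupp.sum, map_sum]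
    simp only [spec_single]
  have h1 : spec a b C = spec a b C -
      LaurentPolynomial.T (κ₁ * a + κ₂ * b) * spec 0 0 C := by rw [h0, mul_zero, sub_zero]
  rw [h1, h, h, Finset.mul_sum, ← Finset.sum_sub_distrib]
  refine Finset.dvd_sum fun v hv => ?_
  obtain ⟨h2, h3⟩ := hC v (Finsupp.mem_support_iff.1 hv)
  have h4 : (C.coeff v : ZetaRing) * LaurentPolynomial.T (v.1 * a + v.2 * b) -
      LaurentPolynomial.T (κ₁ * a + κ₂ * b) *
        ((C.coeff v : ZetaRing) * LaurentPolynomial.T (v.1 * 0 + v.2 * 0)) =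
      (C.coeff v : ZetaRing) * (LaurentPolynomial.T (v.1 * a + v.2 * b) -
        LaurentPolynomial.T (κ₁ * a + κ₂ * b)) := by
    rw [mul_zero, mul_zero, add_zero, LaurentPolynomial.T_zero]; ring
  rw [h4]
  apply Dvd.dvd.mul_left
  apply cyclotomicZeta_dvd
  rw [show v.1 * a + v.2 * b - (κ₁ * a + κ₂ * b) = (v.1 - κ₁) * a + (v.2 - κ₂) * b by ring]
  exact (h2.mul_right _).add (h3.mul_right _)

/-- The coefficient of `q^N` in `θ(mz)` is a sum of differences `± (ζ^{nm/2} - ζ^{-nm/2})` with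
`n² = 8 N + 1`. -/
theorem cyclotomicZeta_dvd_coeff_th {ℓ : ℕ} {N : ℕ} {m : ℤ}
    (h : ∀ n : ℤ, n ^ 2 = 8 * N + 1 → (ℓ : ℤ) ∣ n * m) : cyclotomicZeta ℓ ∣ coeff N (th 0 m) := by
  rw [coeff_th_zero]
  refine Finset.dvd_sum fun i _ => ?_
  split_ifs with hi
  · apply Dvd.dvd.mul_left
    apply cyclotomicZeta_dvd
    rw [sub_neg_eq_add, ← two_mul]
    apply mul_dvd_mul_left
    rw [smul_eq_mul]
    apply h
    have h1 := two_mul_tri i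
    have h2 : tri (i : ℤ) = N := by rw [← hi, tri]; norm_cast
    rw [h2] at h1
    linear_combination -4 * h1
  · exact dvd_zero _

theorem sq_of_coeff_th_ne_zero {N : ℕ} {m : ℤ} (h : coeff N (th 0 m) ≠ 0) :
    ∃ n : ℤ, n ^ 2 = 8 * N + 1 := by
  by_contra! hn
  apply h
  rw [coeff_th_zero]
  refine Finset.sum_eq_zero fun i _ => if_neg fun hi => ?_
  have h1 := two_mul_tri i
  have h2 : tri (i : ℤ) = N := by rw [← hi, tri]; norm_cast
  rw [h2] at h1
  exact hn (2 * i + 1) (by linear_combination -4 * h1)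

theorem coeff_qPow_mul_ofQSeries {d : ZetaRing} {P : QSeries} {s x : ℚ}
    (h : ∀ N : ℕ, x = s + N → d ∣ coeff N P) : d ∣ (qPow s * ofQSeries P).coeff x := by
  have h1 : (qPow s * ofQSeries P).coeff x = (ofQSeries P).coeff (x - s) := by
    have := HahnSeries.coeff_single_mul_add (r := (1 : ZetaRing)) (x := ofQSeries P) (a := x - s)
      (b := s)
    rwa [sub_add_cancel, one_mul] at this
  rw [h1]
  by_cases hN : ∃ N : ℕ, x - s = N
  · obtain ⟨N, hN⟩ := hN
    rw [hN, ofQSeries, HahnSeries.ofPowerSeries_apply_coeff]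
    exact h N (by linarith)
  · rw [ofQSeries, HahnSeries.ofPowerSeries_apply, HahnSeries.embDomain_of_notMem_range]
    · exact dvd_zero _
    · rintro ⟨N, hN'⟩
      exact hN ⟨N, hN'.symm⟩

/-- The form `x² + y²` is anisotropic modulo a prime `ℓ ≡ 3 (mod 4)`. -/
theorem int_dvd_of_sq_add_sq {ℓ : ℕ} (hp : ℓ.Prime) (h3 : ℓ % 4 = 3) {x y : ℤ}
    (h : (ℓ : ℤ) ∣ x ^ 2 + y ^ 2) : (ℓ : ℤ) ∣ x ∧ (ℓ : ℤ) ∣ y := by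
  have := Fact.mk hp
  rw [← CharP.intCast_eq_zero_iff (ZMod ℓ) ℓ] at *
  push_cast at h
  have hy : (y : ZMod ℓ) = 0 := by
    by_contra hy
    refine ZMod.exists_sq_eq_neg_one_iff.1 ⟨(x : ZMod ℓ) / (y : ZMod ℓ), ?_⟩ h3
    field_simp
    linear_combination -h
  refine ⟨?_, (CharP.intCast_eq_zero_iff (ZMod ℓ) ℓ y).1 hy⟩
  rw [hy] at h
  simpa using h

/-- The form `x² + 3 y²` is anisotropic modulo an odd prime `ℓ ≡ 2 (mod 3)`. -/
theorem int_dvd_of_sq_add_three_mul_sq {ℓ : ℕ} (hp : ℓ.Prime) (h3 : ℓ % 3 = 2) (h2 : ℓ ≠ 2)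
    {x y : ℤ} (h : (ℓ : ℤ) ∣ x ^ 2 + 3 * y ^ 2) : (ℓ : ℤ) ∣ x ∧ (ℓ : ℤ) ∣ y := by
  have := Fact.mk hp
  have h20 : (2 : ZMod ℓ) ≠ 0 := by
    intro h0
    have := (CharP.cast_eq_zero_iff (ZMod ℓ) ℓ 2).1 (by exact_mod_cast h0)
    exact h2 ((Nat.prime_dvd_prime_iff_eq hp Nat.prime_two).1 this)
  rw [← CharP.intCast_eq_zero_iff (ZMod ℓ) ℓ] at *
  push_cast at h
  have hy : (y : ZMod ℓ) = 0 := by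
    by_contra hy
    -- `w` is a primitive cube root of unity, which does not exist as `ℓ - 1` is prime to `3`
    obtain ⟨w, hw⟩ : ∃ w : ZMod ℓ, w ^ 2 + w + 1 = 0 := by
      refine ⟨((x : ZMod ℓ) / y - 1) / 2, ?_⟩
      field_simp
      linear_combination h
    have hw3 : w ^ 3 = 1 := by linear_combination (w - 1) * hw
    have hw0 : w ≠ 0 := by rintro rfl; simp at hw
    have h1 := ZMod.pow_card_sub_one_eq_one hw0
    obtain ⟨j, hj⟩ : ∃ j, ℓ - 1 = 3 * j + 1 := ⟨(ℓ - 1) / 3, by have := hp.two_le; omega⟩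
    rw [hj, pow_succ, pow_mul, hw3, one_pow, one_mul] at h1
    rw [h1] at hw
    have h30 : ((3 : ℕ) : ZMod ℓ) = 0 := by push_cast; linear_combination hw
    have := (Nat.prime_dvd_prime_iff_eq hp Nat.prime_three).1
      ((CharP.cast_eq_zero_iff (ZMod ℓ) ℓ 3).1 h30)
    omega
  refine ⟨?_, (CharP.intCast_eq_zero_iff (ZMod ℓ) ℓ y).1 hy⟩
  rw [hy] at h
  simpa using h

theorem cyclotomicZeta_two : cyclotomicZeta 2 = LaurentPolynomial.T 2 + 1 := by
  simp [cyclotomicZeta, zeta]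

/-- The product `θ(az) θ*(bz)` at `ζ^a = -1`, `ζ^b = 1` is `∏ (1 - q^{2n})²`, by Euler's identity
`∏ (1 + q^n) (1 - q^{2n-1}) = 1`; here for finite products that are long enough. -/
theorem coeff_odd_prod_eq_zero (R : Type*) [CommRing R] {N M : ℕ} (hN : Odd N) (hM : N ≤ M) :
    coeff N ((∏ k ∈ Finset.range M, (1 - X ^ (k + 1)) * (1 + X ^ (k + 1)) * (1 + X ^ (k + 1))) *
      ∏ k ∈ Finset.range M, ((1 - X ^ (k + 1)) * (1 + X ^ (k + 1)) * (1 + X ^ (k + 1)) *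
        (1 - X ^ (2 * (k + 1) - 1)) * (1 - X ^ (2 * (k + 1) - 1)) : PowerSeries R)) = 0 := by
  -- `e1` gives Euler's identity, `e2` turns factors `(1 + q^n) (1 - q^n)` into series in `q²`
  have e1 : (∏ k ∈ Finset.range M, (1 + X ^ (k + 1))) * (∏ k ∈ Finset.range M,
      (1 - X ^ (2 * (k + 1) - 1))) * qFac R M = qFac R (2 * M) := by
    rw [qFac, qFac, prod_range_two_mul, ← Finset.prod_mul_distrib, ← Finset.prod_mul_distrib]
    refine Finset.prod_congr rfl fun k _ => ?_
    rw [show 2 * (k + 1) - 1 = 2 * k + 1 by omega]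
    ring
  have e2 : (∏ k ∈ Finset.range M, (1 + X ^ (k + 1))) * qFac R M =
      expand 2 two_ne_zero (qFac R M) := by
    rw [qFac, map_prod, ← Finset.prod_mul_distrib]
    refine Finset.prod_congr rfl fun k _ => ?_
    rw [map_sub, map_one, map_pow, expand_X]
    ring
  have e3 := X_pow_dvd_qFac_sub (R := R) M M
  simp only [Finset.prod_mul_distrib]
  change coeff N (qFac R M * _ * _ * (qFac R M * _ * _ * _ * _)) = 0
  generalize (∏ k ∈ Finset.range M, (1 + X ^ (k + 1)) : PowerSeries R) = P at *
  generalize (∏ k ∈ Finset.range M, (1 - X ^ (2 * (k + 1) - 1)) : PowerSeries R) = O at *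
  rw [← two_mul, ← e1] at e3
  have e4 : X ^ (N + 1) ∣ P * O - 1 := by
    have e5 : P * O - 1 = (P * O * qFac R M - qFac R M) * qFacInv R M := by
      linear_combination (1 - P * O) * qFac_mul_qFacInv (R := R) M
    rw [e5]
    exact ((pow_dvd_pow _ (by omega)).trans e3).mul_right _
  have e6 : X ^ (N + 1) ∣ qFac R M * P * P * (qFac R M * P * P * O * O) -
      expand 2 two_ne_zero (qFac R M ^ 2) := by
    rw [map_pow, ← e2, show qFac R M * P * P * (qFac R M * P * P * O * O) - (P * qFac R M) ^ 2 =
      (P * O - 1) * ((P * O + 1) * (P * qFac R M) ^ 2) by ring]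
    exact e4.mul_right _
  rw [coeff_congr e6]
  exact coeff_expand_of_not_dvd _ _ _ fun h => by
    rw [← even_iff_two_dvd] at h
    exact (Nat.not_even_iff_odd.2 hN) h

/-- For odd `a` and even `b`, the product `θ(az) θ*(bz)` becomes a constant multiple of
`∏ (1 - q^{2n})²` modulo `Φ_2(ζ) = ζ + 1`. -/
theorem cyclotomicZeta_two_dvd_coeff {a b : ℤ} (ha : Odd a) (hb : Even b) {N : ℕ} (hN : Odd N) :
    cyclotomicZeta 2 ∣ coeff N (th 0 a * thetaStarSeries b) := by
  rw [th_zero_eq, thetaStarSeries]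
  have h1 : X ^ (N + 1) ∣
      C (zetaHalf a - zetaHalf (-a)) * qProd (thetaFac a) *
        (C (zetaHalf b + zetaHalf (-b)) * qProd (thetaStarFac b)) -
      C (zetaHalf a - zetaHalf (-a)) * C (zetaHalf b + zetaHalf (-b)) *
        ((∏ k ∈ Finset.range N, thetaFac a (k + 1)) *
          ∏ k ∈ Finset.range N, thetaStarFac b (k + 1)) := by
    have h2 := X_pow_dvd_qProd_sub _ (X_pow_dvd_thetaFac a) (le_refl N)
    have h3 := X_pow_dvd_qProd_sub _ (X_pow_dvd_thetaStarFac b) (le_refl N)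
    generalize (∏ k ∈ Finset.range N, thetaFac a (k + 1)) = A at *
    generalize (∏ k ∈ Finset.range N, thetaStarFac b (k + 1)) = B at *
    have e : C (zetaHalf a - zetaHalf (-a)) * qProd (thetaFac a) *
        (C (zetaHalf b + zetaHalf (-b)) * qProd (thetaStarFac b)) -
      C (zetaHalf a - zetaHalf (-a)) * C (zetaHalf b + zetaHalf (-b)) * (A * B) =
      (qProd (thetaFac a) - A) * (C (zetaHalf a - zetaHalf (-a)) *
        C (zetaHalf b + zetaHalf (-b)) * qProd (thetaStarFac b)) +
      (qProd (thetaStarFac b) - B) * (C (zetaHalf a - zetaHalf (-a)) *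
        C (zetaHalf b + zetaHalf (-b)) * A) := by ring
    rw [e]
    exact (h2.mul_right _).add (h3.mul_right _)
  rw [coeff_congr h1, ← Ideal.mem_span_singleton, ← Ideal.Quotient.eq_zero_iff_mem, ← coeff_map]
  set φ := Ideal.Quotient.mk (Ideal.span {cyclotomicZeta 2}) with hφ
  have hφ2 : φ (LaurentPolynomial.T 2) = -1 := by
    have h2 : φ (LaurentPolynomial.T 2 + 1) = 0 :=
      (congrArg φ cyclotomicZeta_two).symm.trans
        (Ideal.Quotient.eq_zero_iff_mem.2 (Ideal.mem_span_singleton_self _))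
    rw [map_add, map_one] at h2
    linear_combination h2
  have hφT : ∀ u v : ℤ, (4 : ℤ) ∣ u - v →
      φ (LaurentPolynomial.T u) = φ (LaurentPolynomial.T v) := fun u v h => by
    rw [hφ, Ideal.Quotient.eq, Ideal.mem_span_singleton]
    exact cyclotomicZeta_dvd 2 (by simpa using h)
  obtain ⟨c, rfl⟩ := ha
  obtain ⟨d, rfl⟩ := hb
  have z1 : φ (zeta (2 * c + 1)) = -1 := by
    rw [zeta, hφT _ 2 ⟨c, by ring⟩, hφ2]
  have z2 : φ (zeta (-(2 * c + 1))) = -1 := by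
    rw [zeta, hφT _ 2 ⟨-c - 1, by ring⟩, hφ2]
  have z0 : φ (LaurentPolynomial.T 0) = 1 := by rw [LaurentPolynomial.T_zero, map_one]
  have z3 : φ (zeta (d + d)) = 1 := by rw [zeta, hφT _ 0 ⟨d, by ring⟩, z0]
  have z4 : φ (zeta (-(d + d))) = 1 := by rw [zeta, hφT _ 0 ⟨-d, by ring⟩, z0]
  have z5 : φ (zeta (2 * (d + d))) = 1 := by rw [zeta, hφT _ 0 ⟨2 * d, by ring⟩, z0]
  have z6 : φ (zeta (-(2 * (d + d)))) = 1 := by rw [zeta, hφT _ 0 ⟨-2 * d, by ring⟩, z0]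
  generalize zetaHalf (2 * c + 1) - zetaHalf (-(2 * c + 1)) = c₁
  generalize zetaHalf (d + d) + zetaHalf (-(d + d)) = c₂
  have e1 : ∀ n, PowerSeries.map φ (thetaFac (2 * c + 1) n) =
      (1 - X ^ n) * (1 + X ^ n) * (1 + X ^ n) := fun n => by
    simp only [thetaFac, map_mul, map_sub, map_one, map_pow, map_X, cst, map_C, z1, z2]
    rw [map_neg, map_one]
    ring
  have e2 : ∀ n, PowerSeries.map φ (thetaStarFac (d + d) n) =
      (1 - X ^ n) * (1 + X ^ n) * (1 + X ^ n) * (1 - X ^ (2 * n - 1)) *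
        (1 - X ^ (2 * n - 1)) := fun n => by
    simp only [thetaStarFac, map_mul, map_sub, map_add, map_one, map_pow, map_X, cst, map_C, z3,
      z4, z5, z6, one_mul]
  simp only [map_mul (PowerSeries.map φ), map_C, map_prod, e1, e2]
  rw [mul_assoc, coeff_C_mul, coeff_C_mul, coeff_odd_prod_eq_zero _ hN le_rfl, mul_zero, mul_zero]

end CyclotomicDivisibility

/-! ### The theta blocks -/

section Blocks

open PowerSeries

theorem qPow_mul_qPow (s t : ℚ) : qPow s * qPow t = qPow (s + t) := by
  simp [qPow, HahnSeries.single_mul_single]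

theorem qPow_pow (s : ℚ) (n : ℕ) : qPow s ^ n = qPow (n * s) := by
  simp [qPow, HahnSeries.single_pow]

/-- The inverse of the power series `et G 0`. -/
noncomputable def etInv (G : Type*) [AddCommGroup G] : PowerSeries (AddMonoidAlgebra ℤ G) :=
  invOfUnit (et G 0) 1

theorem et_mul_etInv (G : Type*) [AddCommGroup G] : et G 0 * etInv G = 1 := by
  refine mul_invOfUnit _ _ ?_
  rw [Units.val_one, et_zero_eq, ← coeff_zero_eq_constantCoeff_apply]
  have h := coeff_pentagonalSeries_pentagonal (R := AddMonoidAlgebra ℤ G) 0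
  simpa [pentagonal] using h

theorem map_spec_etInv (a b : ℤ) : PowerSeries.map (spec a b) (etInv (ℤ × ℤ)) = etInv ℤ := by
  refine left_inv_eq_right_inv (a := et ℤ 0) ?_ (et_mul_etInv ℤ)
  rw [← map_spec_et a b, ← map_mul, mul_comm, et_mul_etInv, map_one]

theorem etaInv_eq (a b : ℤ) :
    etaInv = qPow (-(1 / 24)) * ofQSeries (PowerSeries.map (spec a b) (etInv (ℤ × ℤ))) := by
  rw [map_spec_etInv, etaInv, eulerProd_eq]
  rfl

theorem et_pow_mul_etInv_pow_mul {G : Type*} [AddCommGroup G] (r : ℕ)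
    (P : PowerSeries (AddMonoidAlgebra ℤ G)) : et G 0 ^ r * (etInv G ^ r * P) = P := by
  rw [← mul_assoc, ← mul_pow, et_mul_etInv, one_pow, one_mul]

theorem C_dvd_of_forall_dvd_coeff {R : Type*} [CommRing R] {d : R} {A : PowerSeries R}
    (h : ∀ N, d ∣ coeff N A) : C d ∣ A := by
  choose g hg using h
  exact ⟨mk g, by ext N; rw [coeff_C_mul, coeff_mk, hg]⟩

theorem dvd_coeff_of_C_dvd {R : Type*} [CommRing R] {d : R} {A : PowerSeries R}
    (h : C d ∣ A) (N : ℕ) : d ∣ coeff N A := by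
  obtain ⟨B, rfl⟩ := h
  exact ⟨_, coeff_C_mul _ _ _⟩

/-- The coefficients of `θ(mz)` vanish modulo `Φ_2(ζ) = ζ + 1` for even `m`. -/
theorem C_cyclotomicZeta_two_dvd_th {m : ℤ} (hm : Even m) : C (cyclotomicZeta 2) ∣ th 0 m :=
  C_dvd_of_forall_dvd_coeff fun _ =>
    cyclotomicZeta_dvd_coeff_th fun _ _ => (hm.mul_left _).two_dvd

theorem cyclotomicZeta_dvd_coeff_th_of_dvd {ℓ N : ℕ} (hp : ℓ.Prime) (h : (ℓ : ℤ) ∣ 8 * N + 1)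
    (m : ℤ) : cyclotomicZeta ℓ ∣ coeff N (th 0 m) :=
  cyclotomicZeta_dvd_coeff_th fun _ hn =>
    (((Nat.prime_iff_prime_int.1 hp).dvd_of_dvd_pow (hn ▸ h :)).mul_right m)

/-- If the exponents that occur in the `q^N`-coefficient of a quotient of a product `P` by a power
of `et _ 0` agree modulo `2 ℓ`, then the specializations of this coefficient are divisible by
`Φ_ℓ(ζ)`, provided `P` vanishes at `ζ = 1`. -/
theorem cyclotomicZeta_dvd_coeff_map_spec {ℓ N : ℕ} (r : ℕ) {F P : TwoVar} (a b κ₁ κ₂ : ℤ)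
    (hF : et _ 0 ^ r * F = P) (hP : PowerSeries.map (spec 0 0) P = 0)
    (hC : ∀ v, (coeff N F).coeff v ≠ 0 → (2 * ℓ : ℤ) ∣ v.1 - κ₁ ∧ (2 * ℓ : ℤ) ∣ v.2 - κ₂) :
    cyclotomicZeta ℓ ∣ coeff N (PowerSeries.map (spec a b) F) := by
  rw [coeff_map]
  refine cyclotomicZeta_dvd_spec ℓ _ a b κ₁ κ₂ hC ?_
  have h := congrArg (PowerSeries.map (spec 0 0)) hF
  rw [hP, map_mul, map_pow, map_spec_et] at h
  rw [← coeff_map, (mul_eq_zero.1 h).resolve_left (pow_ne_zero _ (et_zero_ne_zero ℤ)), map_zero]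

theorem map_spec_zero_th (v : ℤ × ℤ) : PowerSeries.map (spec 0 0) (th 0 v) = 0 := by
  rw [map_spec_th, mul_zero, mul_zero, add_zero, th_zero_zero]

theorem two_mul_dvd {ℓ : ℕ} (h2 : ¬ 2 ∣ ℓ) {x : ℤ} (hx : (ℓ : ℤ) ∣ x) (h : Even x) :
    (2 * ℓ : ℤ) ∣ x :=
  (Nat.isCoprime_iff_coprime.2 (Nat.prime_two.coprime_iff_not_dvd.2 h2)).mul_dvd h.two_dvd hx

theorem not_two_dvd {ℓ : ℕ} (hp : ℓ.Prime) (h2 : ℓ ≠ 2) : ¬ 2 ∣ ℓ := fun h =>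
  h2 ((Nat.prime_dvd_prime_iff_eq Nat.prime_two hp).1 h).symm

theorem dvd_of_dvd_two_mul {ℓ : ℕ} (h2 : ¬ 2 ∣ ℓ) {x : ℤ} (hx : (ℓ : ℤ) ∣ 2 * x) : (ℓ : ℤ) ∣ x :=
  (Nat.isCoprime_iff_coprime.2
    (Nat.prime_two.coprime_iff_not_dvd.2 h2)).symm.dvd_of_dvd_mul_left hx

/-- For `h = 4`, and likewise below for the other values of `h`, the block is `q^{h/24}` times a
power series. -/
theorem phi_four (a b : ℤ) :
    phi 4 a b = qPow (4 / 24) * ofQSeries (th 0 a * thetaStarSeries b) := by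
  rw [phi, theta_eq, thetaStar_eq, map_mul, mul_mul_mul_comm, qPow_mul_qPow]
  norm_num

theorem phi_six (a b : ℤ) :
    phi 6 a b = qPow (6 / 24) * ofQSeries (th 0 a * th 0 b) := by
  rw [phi, theta_eq, theta_eq, map_mul, mul_mul_mul_comm, qPow_mul_qPow]
  norm_num

theorem phi_eight (a b : ℤ) :
    phi 8 a b = qPow (8 / 24) * ofQSeries (PowerSeries.map (spec a b)
      (etInv _ ^ 1 * (th 0 (1, 0) * th 0 (0, 1) * th 0 (1, 1)))) := by
  have h : qPow (-(1 / 24)) * qPow (1 / 8) ^ 3 = qPow (8 / 24) := by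
    rw [qPow_pow, qPow_mul_qPow]; norm_num
  rw [← h, phi]
  simp only [etaInv_eq a b, theta_eq, map_mul, map_pow, map_spec_th, zero_mul, one_mul, zero_add,
    add_zero]
  ring

theorem phi_ten (a b : ℤ) :
    phi 10 a b = qPow (10 / 24) * ofQSeries (PowerSeries.map (spec a b)
      (etInv _ ^ 2 * (th 0 (1, 0) * th 0 (0, 1) * th 0 (1, 1) * th 0 (1, 2)))) := by
  have h : qPow (-(1 / 24)) ^ 2 * qPow (1 / 8) ^ 4 = qPow (10 / 24) := by
    rw [qPow_pow, qPow_pow, qPow_mul_qPow]; norm_num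
  rw [← h, phi]
  simp only [etaInv_eq a b, theta_eq, map_mul, map_pow, map_spec_th, zero_mul, one_mul, zero_add,
    add_zero]
  ring

theorem phi_fourteen (a b : ℤ) :
    phi 14 a b = qPow (14 / 24) * ofQSeries (PowerSeries.map (spec a b)
      (etInv _ ^ 4 * (th 0 (1, 0) * th 0 (0, 1) * th 0 (1, 1) * th 0 (2, 1) * th 0 (3, 1) *
        th 0 (3, 2)))) := by
  have h : qPow (-(1 / 24)) ^ 4 * qPow (1 / 8) ^ 6 = qPow (14 / 24) := by
    rw [qPow_pow, qPow_pow, qPow_mul_qPow]; norm_num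
  rw [← h, phi]
  simp only [etaInv_eq a b, theta_eq, map_mul, map_pow, map_spec_th, zero_mul, one_mul, zero_add,
    add_zero]
  ring

variable {ℓ N : ℕ}

/-- The case `h = 8`: the exponents satisfy `i² - i j + j² = 12 N + 4`, where
`4 (i² - i j + j²) = (2i - j)² + 3 j²`, and both are even. -/
theorem dvd_coeff_A2 (hp : ℓ.Prime) (a b : ℤ) (h3 : ℓ % 3 = 2)
    (hN : (ℓ : ℤ) ∣ 24 * N + 8) :
    cyclotomicZeta ℓ ∣ coeff N (PowerSeries.map (spec a b)
      (etInv _ ^ 1 * (th 0 (1, 0) * th 0 (0, 1) * th 0 (1, 1)))) := by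
  by_cases h2 : ℓ = 2
  · subst h2
    apply dvd_coeff_of_C_dvd
    simp only [map_mul, map_spec_th, zero_mul, one_mul, zero_add, add_zero]
    apply Dvd.dvd.mul_left
    -- one of `a`, `b`, `a + b` is even
    rcases Int.even_or_odd a with ha | ha
    · exact ((C_cyclotomicZeta_two_dvd_th ha).mul_right _).mul_right _
    rcases Int.even_or_odd b with hb | hb
    · exact ((C_cyclotomicZeta_two_dvd_th hb).mul_left _).mul_right _
    · exact (C_cyclotomicZeta_two_dvd_th (ha.add_odd hb)).mul_left _
  have h2' := not_two_dvd hp h2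
  have hF := et_pow_mul_etInv_pow_mul 1
    (th 0 ((1, 0) : ℤ × ℤ) * th 0 (0, 1) * th 0 (1, 1))
  refine cyclotomicZeta_dvd_coeff_map_spec 1 a b 0 0 hF ?_ fun v hv => ?_
  · rw [map_mul, map_spec_zero_th, mul_zero]
  have hs := support_of_heat (heat_A2 (by rwa [pow_one] at hF)) N v hv
  obtain ⟨i, j⟩ := v
  simp only [sub_zero] at hs ⊢
  have hd : (ℓ : ℤ) ∣ (2 * i - j) ^ 2 + 3 * j ^ 2 := by
    rw [show (2 * i - j) ^ 2 + 3 * j ^ 2 = (24 * N + 8) * 2 by linear_combination 2 * hs]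
    exact hN.mul_right _
  obtain ⟨h4, h5⟩ := int_dvd_of_sq_add_three_mul_sq hp h3 h2 hd
  have h6 : (ℓ : ℤ) ∣ i := dvd_of_dvd_two_mul h2' (by simpa using h4.add h5)
  suffices Even i ∧ Even j from ⟨two_mul_dvd h2' h6 this.1, two_mul_dvd h2' h5 this.2⟩
  have he : Even (i ^ 2 - i * j + j ^ 2) := ⟨6 * N + 2, by linarith⟩
  simp only [Int.even_add, Int.even_sub, Int.even_mul, Int.even_pow] at he
  tauto

/-- The case `h = 14`: the exponents satisfy `i² - 3 i j + 3 j² = 48 N + 28`, where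
`4 (i² - 3 i j + 3 j²) = (2i - 3j)² + 3 j²`, and both are even. -/
theorem dvd_coeff_G2 (hp : ℓ.Prime) (a b : ℤ) (h3 : ℓ % 3 = 2)
    (hN : (ℓ : ℤ) ∣ 24 * N + 14) :
    cyclotomicZeta ℓ ∣ coeff N (PowerSeries.map (spec a b)
      (etInv _ ^ 4 * (th 0 (1, 0) * th 0 (0, 1) * th 0 (1, 1) * th 0 (2, 1) * th 0 (3, 1) *
        th 0 (3, 2)))) := by
  by_cases h2 : ℓ = 2
  · subst h2
    apply dvd_coeff_of_C_dvd
    simp only [map_mul, map_spec_th, zero_mul, one_mul, zero_add, add_zero]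
    refine Dvd.dvd.mul_left (((Dvd.dvd.mul_right ?_ _).mul_right _).mul_right _) _
    -- one of `a`, `b`, `a + b` is even
    rcases Int.even_or_odd a with ha | ha
    · exact ((C_cyclotomicZeta_two_dvd_th ha).mul_right _).mul_right _
    rcases Int.even_or_odd b with hb | hb
    · exact ((C_cyclotomicZeta_two_dvd_th hb).mul_left _).mul_right _
    · exact (C_cyclotomicZeta_two_dvd_th (ha.add_odd hb)).mul_left _
  have h2' := not_two_dvd hp h2
  have hF := et_pow_mul_etInv_pow_mul 4
    (th 0 ((1, 0) : ℤ × ℤ) * th 0 (0, 1) * th 0 (1, 1) * th 0 (2, 1) * th 0 (3, 1) * th 0 (3, 2))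
  refine cyclotomicZeta_dvd_coeff_map_spec 4 a b 0 0 hF ?_ fun v hv => ?_
  · rw [map_mul, map_spec_zero_th, mul_zero]
  have hs := support_of_heat (heat_G2 hF) N v hv
  obtain ⟨i, j⟩ := v
  simp only [sub_zero] at hs ⊢
  have hd : (ℓ : ℤ) ∣ (2 * i - 3 * j) ^ 2 + 3 * j ^ 2 := by
    rw [show (2 * i - 3 * j) ^ 2 + 3 * j ^ 2 = (24 * N + 14) * 8 by linear_combination 2 * hs]
    exact hN.mul_right _
  obtain ⟨h4, h5⟩ := int_dvd_of_sq_add_three_mul_sq hp h3 h2 hd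
  have h6 : (ℓ : ℤ) ∣ i := dvd_of_dvd_two_mul h2' (by simpa using h4.add (h5.mul_left 3))
  suffices Even i ∧ Even j from ⟨two_mul_dvd h2' h6 this.1, two_mul_dvd h2' h5 this.2⟩
  have he : Even (i ^ 2 - i * j + j ^ 2) := ⟨24 * N + 14 + (i * j - j ^ 2), by linarith⟩
  simp only [Int.even_add, Int.even_sub, Int.even_mul, Int.even_pow] at he
  tauto

/-- The case `h = 10`: the exponents satisfy `(j - i)² + i² = 24 N + 10`, with `i` odd and `j` even.
Hence they are congruent to `(ℓ, 0)` modulo `2 ℓ`. -/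
theorem dvd_coeff_B2 (hp : ℓ.Prime) (a b : ℤ) (h4 : ℓ % 4 = 3)
    (hN : (ℓ : ℤ) ∣ 24 * N + 10) :
    cyclotomicZeta ℓ ∣ coeff N (PowerSeries.map (spec a b)
      (etInv _ ^ 2 * (th 0 (1, 0) * th 0 (0, 1) * th 0 (1, 1) * th 0 (1, 2)))) := by
  have h2 : ¬ 2 ∣ ℓ := by omega
  have hF := et_pow_mul_etInv_pow_mul 2
    (th 0 ((1, 0) : ℤ × ℤ) * th 0 (0, 1) * th 0 (1, 1) * th 0 (1, 2))
  refine cyclotomicZeta_dvd_coeff_map_spec 2 a b ℓ 0 hF ?_ fun v hv => ?_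
  · rw [map_mul, map_spec_zero_th, mul_zero]
  have hs := support_of_heat (heat_B2 hF) N v hv
  obtain ⟨i, j⟩ := v
  simp only [sub_zero] at hs ⊢
  have hd : (ℓ : ℤ) ∣ (j - i) ^ 2 + i ^ 2 := by
    rw [show (j - i) ^ 2 + i ^ 2 = 24 * N + 10 by linear_combination hs]
    exact hN
  obtain ⟨h5, h6⟩ := int_dvd_of_sq_add_sq hp h4 hd
  have h7 : (ℓ : ℤ) ∣ j := by simpa using h5.add h6
  have hj : Even j := by
    have : Even (j ^ 2) := ⟨12 * N + 5 - i ^ 2 + i * j, by linarith⟩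
    exact (Int.even_pow.1 this).1
  have hi : Odd i := by
    obtain ⟨d, rfl⟩ := hj
    have : Odd (i ^ 2) := ⟨6 * N + 2 + i * d - d ^ 2, by linarith⟩
    exact (Int.odd_pow.1 this).resolve_right two_ne_zero
  refine ⟨two_mul_dvd h2 (dvd_sub_self_right.2 h6) (hi.sub_odd ?_), two_mul_dvd h2 h7 hj⟩
  exact (Int.odd_coe_nat _).2 (Nat.odd_iff.2 (by omega))

/-- The case `h = 6`. The exponents `x`, `y` of the two factors satisfy `3 (x² + y²) = 24 N + 6`. -/
theorem dvd_coeff_th_mul_th (hp : ℓ.Prime) (a b : ℤ) (h4 : ℓ % 4 = 3)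
    (hN : (ℓ : ℤ) ∣ 24 * N + 6) (h3 : ℓ = 3 → ¬ (3 : ℤ) ∣ N) :
    cyclotomicZeta ℓ ∣ coeff N (th 0 a * th 0 b) := by
  rw [coeff_mul]
  refine Finset.dvd_sum fun p hpN => ?_
  have hsum : (p.1 : ℤ) + p.2 = N := by exact_mod_cast Finset.HasAntidiagonal.mem_antidiagonal.1 hpN
  by_cases hA : coeff p.1 (th 0 a) = 0
  · rw [hA, zero_mul]; exact dvd_zero _
  by_cases hB : coeff p.2 (th 0 b) = 0
  · rw [hB, mul_zero]; exact dvd_zero _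
  obtain ⟨x, hx⟩ := sq_of_coeff_th_ne_zero hA
  obtain ⟨y, hy⟩ := sq_of_coeff_th_ne_zero hB
  by_cases hl : ℓ = 3
  · subst hl
    have hN3 := h3 rfl
    -- if `3` divides neither `8 p₁ + 1` nor `8 p₂ + 1`, these squares are `1` modulo `3`, so that
    -- `3` divides `p₁`, `p₂` and their sum `N`
    have key : ∀ {z : ℤ} {m : ℕ}, z ^ 2 = 8 * m + 1 → ¬ ((3 : ℕ) : ℤ) ∣ 8 * m + 1 →
        (m : ℤ) % 3 = 0 := fun {z m} hz hm => by
      obtain ⟨c, rfl | rfl | rfl⟩ : ∃ c, z = 3 * c ∨ z = 3 * c + 1 ∨ z = 3 * c + 2 :=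
        ⟨z / 3, by omega⟩
      · exact absurd ⟨3 * c ^ 2, by push_cast; linear_combination -hz⟩ hm
      · have : 8 * (m : ℤ) = 3 * (3 * c ^ 2 + 2 * c) := by linear_combination -hz
        omega
      · have : 8 * (m : ℤ) = 3 * (3 * c ^ 2 + 4 * c + 1) := by linear_combination -hz
        omega
    by_cases h7 : ((3 : ℕ) : ℤ) ∣ 8 * p.1 + 1
    · exact (cyclotomicZeta_dvd_coeff_th_of_dvd hp h7 a).mul_right _
    by_cases h8 : ((3 : ℕ) : ℤ) ∣ 8 * p.2 + 1
    · exact (cyclotomicZeta_dvd_coeff_th_of_dvd hp h8 b).mul_left _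
    have h9 := key hx h7
    have h10 := key hy h8
    omega
  · have hd : (ℓ : ℤ) ∣ 3 * (x ^ 2 + y ^ 2) := by
      rw [show 3 * (x ^ 2 + y ^ 2) = 24 * N + 6 by linear_combination 3 * hx + 3 * hy + 24 * hsum]
      exact hN
    have h5 : (ℓ : ℤ) ∣ x ^ 2 + y ^ 2 := by
      refine ((Nat.prime_iff_prime_int.1 hp).dvd_or_dvd hd).resolve_left fun h => hl ?_
      exact (Nat.prime_dvd_prime_iff_eq hp Nat.prime_three).1 (by exact_mod_cast h)
    obtain ⟨h6, -⟩ := int_dvd_of_sq_add_sq hp h4 h5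
    refine (cyclotomicZeta_dvd_coeff_th_of_dvd hp ?_ a).mul_right _
    rw [← hx]
    exact h6.pow two_ne_zero

/-- The case `h = 4`. The exponents `x`, `y` of the two factors satisfy `3 x² + y² = 24 N + 4`. -/
theorem dvd_coeff_th_mul_thetaStarSeries (hp : ℓ.Prime) (a b : ℤ) (h3 : ℓ % 3 = 2)
    (hN : (ℓ : ℤ) ∣ 24 * N + 4) (h2 : ℓ = 2 → Odd N) :
    cyclotomicZeta ℓ ∣ coeff N (th 0 a * thetaStarSeries b) := by
  by_cases hl : ℓ = 2
  · subst hl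
    rcases Int.even_or_odd a with ha | ha
    · exact dvd_coeff_of_C_dvd ((C_cyclotomicZeta_two_dvd_th ha).mul_right _) _
    rcases Int.even_or_odd b with hb | hb
    · exact cyclotomicZeta_two_dvd_coeff ha hb (h2 rfl)
    -- for odd `b` the factor `ζ^{b/2} + ζ^{-b/2}` of `θ*(bz)` vanishes at `ζ = -1`
    · refine dvd_coeff_of_C_dvd (Dvd.dvd.mul_left (Dvd.dvd.mul_right (map_dvd C ?_) _) _) _
      obtain ⟨d, rfl⟩ := hb
      have h4 := cyclotomicZeta_dvd 2 (u := -(2 * d + 1)) (v := 2 * d + 1 + 2)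
        ⟨-d - 1, by push_cast; ring⟩
      have h5 : cyclotomicZeta 2 ∣
          LaurentPolynomial.T (2 * d + 1) * (LaurentPolynomial.T 2 + 1) :=
        cyclotomicZeta_two ▸ dvd_mul_left _ _
      have h6 := h4.add h5
      rw [LaurentPolynomial.T_add _ 2] at h6
      rw [zetaHalf, zetaHalf]
      convert h6 using 1
      ring
  rw [coeff_mul]
  refine Finset.dvd_sum fun p hpN => ?_
  have hsum : (p.1 : ℤ) + p.2 = N := by exact_mod_cast Finset.HasAntidiagonal.mem_antidiagonal.1 hpN
  by_cases hA : coeff p.1 (th 0 a) = 0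
  · rw [hA, zero_mul]; exact dvd_zero _
  by_cases hB : coeff p.2 (thetaStarSeries b) = 0
  · rw [hB, mul_zero]; exact dvd_zero _
  obtain ⟨x, hx⟩ := sq_of_coeff_th_ne_zero hA
  obtain ⟨y, hy⟩ := sq_of_coeff_thetaStarSeries_ne_zero hB
  have hd : (ℓ : ℤ) ∣ y ^ 2 + 3 * x ^ 2 := by
    rw [show y ^ 2 + 3 * x ^ 2 = 24 * N + 4 by linear_combination 3 * hx + hy + 24 * hsum]
    exact hN
  obtain ⟨-, h6⟩ := int_dvd_of_sq_add_three_mul_sq hp h3 hl hd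
  refine (cyclotomicZeta_dvd_coeff_th_of_dvd hp ?_ a).mul_right _
  rw [← hx]
  exact h6.pow two_ne_zero

end Blocks

end ThetaBlock

theorem lemma3p2 (k ℓ h t : ℕ) (δ : ℤ)
    (hgen : ThetaBlock.IsGenericProgression k ℓ h t δ)
    (hh : h = 4 ∨ h = 6 ∨ h = 8 ∨ h = 10 ∨ h = 14)
    (a b : ℤ) (n : ℕ) :
    ThetaBlock.cyclotomicZeta ℓ ∣
      (ThetaBlock.phi h a b).coeff ((ℓ : ℚ) * (n : ℚ) + (δ : ℚ) + (h : ℚ) / 24) := by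
  obtain ⟨⟨hp, -, -, -, hadd, hδ, hcond, hnd⟩, -⟩ := hgen
  have hN : ∀ N : ℕ, (ℓ : ℚ) * n + δ + (h : ℚ) / 24 = (h : ℚ) / 24 + N → (N : ℤ) = ℓ * n + δ :=
    fun N hN => by
      have : (N : ℚ) = ℓ * n + δ := by linarith
      exact_mod_cast this
  have hdvd : ∀ N : ℕ, (N : ℤ) = ℓ * n + δ → (ℓ : ℤ) ∣ 24 * N + h := fun N hN => by
    obtain ⟨c, hc⟩ := hδ.dvd
    have h1 : (k : ℤ) + h = ℓ * t := by exact_mod_cast hadd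
    exact ⟨24 * n - c + t, by rw [hN]; linear_combination h1 - hc⟩
  have hndN : ∀ N : ℕ, (N : ℤ) = ℓ * n + δ → ℓ ∣ 24 → ¬ (ℓ : ℤ) ∣ N := fun N hN h24 h => by
    refine hnd h24 ?_
    rw [hN] at h
    exact (Int.dvd_add_right (dvd_mul_right _ _)).1 h
  have h3 : h = 4 ∨ h = 8 ∨ h = 14 → ℓ % 3 = 2 := fun h' => by
    rcases hcond with h1 | h1 | h1
    · exact h1.2
    · omega
    · omega
  have h4 : h = 6 ∨ h = 10 → ℓ % 4 = 3 := fun h' => by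
    rcases hcond with h1 | h1 | h1
    · omega
    · exact h1.2
    · omega
  rcases hh with rfl | rfl | rfl | rfl | rfl
  · rw [ThetaBlock.phi_four]
    refine ThetaBlock.coeff_qPow_mul_ofQSeries fun N hx => ?_
    refine ThetaBlock.dvd_coeff_th_mul_thetaStarSeries hp a b (h3 (by simp))
      (hdvd N (hN N (by exact_mod_cast hx))) fun h2 => ?_
    have := hndN N (hN N (by exact_mod_cast hx)) (by rw [h2]; norm_num)
    rw [h2] at this
    exact Nat.not_even_iff_odd.1 fun he => this (by exact_mod_cast he.two_dvd)
  · rw [ThetaBlock.phi_six]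
    refine ThetaBlock.coeff_qPow_mul_ofQSeries fun N hx => ?_
    refine ThetaBlock.dvd_coeff_th_mul_th hp a b (h4 (by simp))
      (hdvd N (hN N (by exact_mod_cast hx))) fun h2 => ?_
    have := hndN N (hN N (by exact_mod_cast hx)) (by rw [h2]; norm_num)
    rwa [h2] at this
  · rw [ThetaBlock.phi_eight]
    exact ThetaBlock.coeff_qPow_mul_ofQSeries fun N hx =>
      ThetaBlock.dvd_coeff_A2 hp a b (h3 (by simp)) (hdvd N (hN N (by exact_mod_cast hx)))
  · rw [ThetaBlock.phi_ten]
    exact ThetaBlock.coeff_qPow_mul_ofQSeries fun N hx =>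
      ThetaBlock.dvd_coeff_B2 hp a b (h4 (by simp)) (hdvd N (hN N (by exact_mod_cast hx)))
  · rw [ThetaBlock.phi_fourteen]
    exact ThetaBlock.coeff_qPow_mul_ofQSeries fun N hx =>
      ThetaBlock.dvd_coeff_G2 hp a b (h3 (by simp)) (hdvd N (hN N (by exact_mod_cast hx)))
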